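/- **Setting.** For a dyadic interval $I\subseteq[0,1)$ let $I_-,I_+$ be its left and right halves, $h_I=|I|^{-1/2}(\mathbf 1_{I_+}-\mathbf 1_{I_-})$, and let $\mathcal D_{\rm odd}$ be the set of dyadic $I\subseteq[0,1)$ with $|I|=2^{-k}$, $k$ odd. For $f:\mathbb R\to\mathbb R^2$ write $(f,h_I)=\int f\,h_I\,dx\in\mathbb R^2$ and $$\mathbb S f=\sum_{I\in\mathcal D_{\rm odd}}(f,h_I)\,[h_{I_+}-h_{I_-}],\qquad \mathbb S_0f=\sum_{I\in\mathcal D_{\rm odd}}\big[(f,h_{I_+})h_{I_-}-(f,h_{I_-})h_{I_+}\big],$$ $\mathbb S^*f=\sum_{I\in\mathcal D_{\rm odd}}(f,h_{I_+}-h_{I_-})\,h_I$ (the adjoint of $\mathbb S$ in the unweighted $L^2$), and $\mathcal H^{\rm dy}=c_1(\mathbb S-\mathbb S^*)+c_2\mathbb S_0$ with $c_1,c_2\in\mathbb R$. For a $2\times2$ matrix weight $W$ on $[0,1)$, $\|f\|_{L^2(W)}^2=\int_0^1(W f,f)_{\mathbb R^2}\,dx$. **The weight.** Let $q=1/10$,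 $Q$ large, $r=2-1/Q$, $\alpha_0,\beta_0>0$, $\delta_0=q(\beta_0/\alpha_0)^{1/2}$, let $\mathbf a_0,\mathbf b_0$ be an orthonormal basis of $\mathbb R^2$, and let $N\in\mathbb N$. Put $\alpha_0^\#=Q/\beta_0$, $\beta_0^\#=Q/\alpha_0$ and, recursively, $\delta_n=q(\beta_n/\alpha_n)^{1/2}$, $$\tilde\alpha_n=\tfrac{\alpha_n-\delta_n^2\beta_n}{1-\delta_n^2},\quad \tilde\beta_n=\tfrac{\beta_n-\delta_n^2\alpha_n}{1-\delta_n^2},\quad \tilde\alpha_n^\#=\tfrac{\alpha_n^\#-\delta_n^2\beta_n^\#}{1-\delta_n^2},\quad \tilde\beta_n^\#=\tfrac{\beta_n^\#-\delta_n^2\alpha_n^\#}{1-\delta_n^2},\quad s_n=\tilde\alpha_n\tilde\beta_n^\#/Q,$$ $$\alpha_{n+1}=r\tilde\alpha_n,\quad \beta_{n+1}=\tilde\beta_n/(s_nr),\quad \alpha_{n+1}^\#=r\tilde\alpha_n^\#,\quad \beta_{n+1}^\#=\tilde\beta_n^\#/(s_nr).$$ The averages of $W^{-1}$ and $W$ over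 dyadic intervals are prescribed in the form $\langle W^{-1}\rangle=\alpha\,\mathbf a\mathbf a^*+\beta\,\mathbf b\mathbf b^*$, $\langle W\rangle=\beta^\#\mathbf a\mathbf a^*+\alpha^\#\mathbf b\mathbf b^*$ as follows. The only stopping interval of generation $0$ is $[0,1)$, with basis $\mathbf a_0,\mathbf b_0$. A stopping interval $I$ of generation $n$, with basis $\mathbf a_I,\mathbf b_I$, has eigenvalues $\alpha_n,\beta_n,\alpha_n^\#,\beta_n^\#$. If $n<N$, its halves $I_\pm$ have eigenvalues $\tilde\alpha_n,\tilde\beta_n,\tilde\alpha_n^\#,\tilde\beta_n^\#$ and bases $$\mathbf a_{I_\pm}=(1+\delta_n^2)^{-1/2}(\mathbf a_I\pm\delta_n\mathbf b_I),\qquad \mathbf b_{I_\pm}=(1+\delta_n^2)^{-1/2}(\mathbf b_I\mp\delta_n\mathbf a_I).$$ For $J=I_\pm$, the right half $J_+$ is a stopping interval of generation $n+1$ with basis $\mathbf a_J,\mathbf b_J$, and the left half $J_-$ is terminal, with the same basis and eigenvalues $$(2-r)\tilde\alpha_n,\quad \big(2-\tfrac1{s_nr}\big)\tilde\beta_n,\quad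 (2-r)\tilde\alpha_n^\#,\quad \big(2-\tfrac1{s_nr}\big)\tilde\beta_n^\#$$ for $\alpha,\beta,\alpha^\#,\beta^\#$ respectively. Finally, let $K$ be a terminal interval or a stopping interval of generation $N$, with basis $\mathbf a,\mathbf b$ and eigenvalues $\alpha,\beta,\alpha^\#,\beta^\#$. On its halves $K_\pm$ the weight is constant: $$W=\beta^\#\Big(1\pm\sqrt{1-\tfrac1{\alpha\beta^\#}}\Big)\mathbf a\mathbf a^*+\alpha^\#\Big(1\pm\sqrt{1-\tfrac1{\alpha^\#\beta}}\Big)\mathbf b\mathbf b^* .$$ This defines the weight $W=W_{Q,\alpha_0,\beta_0,\mathbf a_0,\mathbf b_0,N}$ on $[0,1)$. **Statement.** For an operator $T$ consider the following assertion. $(\ast)$ There are $c>0$ and $Q_0$ such that for every $Q\ge Q_0$ there is $\delta_*>0$ such that for all $\alpha_0,\beta_0>0$ with $\delta_0=q(\beta_0/\alpha_0)^{1/2}\le\delta_*$ there is $N_0$ such that for all $N\ge N_0$, all orthonormal bases $\mathbf a_0,\mathbf b_0$ and $e\in\{\mathbf a_0,\ \mathbf a_0+\mathbf b_0\}$, the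 weight $W$ above and $f=W^{-1}\mathbf 1_{[0,1)}e$ satisfy $$\|Tf\|_{L^2(W)}\ \ge\ c\,Q^{3/2}\,\|f\|_{L^2(W)} .$$ Then: 1. for all real $c_1\ne0$ and $c_2$, $(\ast)$ holds for $T=\mathcal H^{\rm dy}=c_1(\mathbb S-\mathbb S^*)+c_2\mathbb S_0$ (with $c,Q_0,\delta_*,N_0$ allowed to depend on $c_1,c_2$); 2. $(\ast)$ holds for the odd Haar shift $T=\mathbb S$. -/

import Mathlib

open MeasureTheory
open scoped Matrix

noncomputable section

namespace DyadicModel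

/-! ### Dyadic intervals of `[0,1)` and Haar functions

The dyadic interval of generation `k` and position `j < 2 ^ k` is `[j 2⁻ᵏ, (j+1) 2⁻ᵏ)`.  Its left
child `I₋` is `(k+1, 2j)`, its right child `I₊` is `(k+1, 2j+1)`. -/

/-- The dyadic interval `[j 2⁻ᵏ, (j+1) 2⁻ᵏ)`. -/
def dyadic (k j : ℕ) : Set ℝ := Set.Ico ((j : ℝ) / 2 ^ k) (((j : ℝ) + 1) / 2 ^ k)

/-- The `L²`-normalized Haar function `h_I = |I|^{-1/2} (1_{I₊} - 1_{I₋})`, where `|I| = 2⁻ᵏ`. -/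
def haar (k j : ℕ) (x : ℝ) : ℝ :=
  √((2 : ℝ) ^ k) *
    ((dyadic (k + 1) (2 * j + 1)).indicator 1 x - (dyadic (k + 1) (2 * j)).indicator 1 x)

/-- The vector `(f, h_I)_{L²} = ∫ h_I f`. -/
def haarCoeff (f : ℝ → Fin 2 → ℝ) (k j : ℕ) : Fin 2 → ℝ := ∫ x, haar k j x • f x

/-! ### Odd Haar shifts

All sums run over the dyadic intervals `I ⊆ [0,1)` of odd generation `2m+1`; for a function with a
finite Haar expansion only finitely many terms are nonzero. -/

/-- Odd Haar shift: `𝕊 f = ∑_I (f, h_I) [h_{I₊} - h_{I₋}]`. -/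
def oddShift (f : ℝ → Fin 2 → ℝ) (x : ℝ) : Fin 2 → ℝ :=
  ∑' m : ℕ, ∑ j ∈ Finset.range (2 ^ (2 * m + 1)),
    (haar (2 * m + 2) (2 * j + 1) x - haar (2 * m + 2) (2 * j) x) • haarCoeff f (2 * m + 1) j

/-- The adjoint in the unweighted `L²`: `𝕊* f = ∑_I (f, h_{I₊} - h_{I₋}) h_I`. -/
def oddShiftAdj (f : ℝ → Fin 2 → ℝ) (x : ℝ) : Fin 2 → ℝ :=
  ∑' m : ℕ, ∑ j ∈ Finset.range (2 ^ (2 * m + 1)),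
    haar (2 * m + 1) j x •
      (haarCoeff f (2 * m + 2) (2 * j + 1) - haarCoeff f (2 * m + 2) (2 * j))

/-- `𝕊₀ f = ∑_I [(f, h_{I₊}) h_{I₋} - (f, h_{I₋}) h_{I₊}]`. -/
def oddShiftZero (f : ℝ → Fin 2 → ℝ) (x : ℝ) : Fin 2 → ℝ :=
  ∑' m : ℕ, ∑ j ∈ Finset.range (2 ^ (2 * m + 1)),
    (haar (2 * m + 2) (2 * j) x • haarCoeff f (2 * m + 2) (2 * j + 1) -
      haar (2 * m + 2) (2 * j + 1) x • haarCoeff f (2 * m + 2) (2 * j))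

/-- The dyadic model operator `c₁ (𝕊 - 𝕊*) + c₂ 𝕊₀`. -/
def modelOp (c₁ c₂ : ℝ) (f : ℝ → Fin 2 → ℝ) (x : ℝ) : Fin 2 → ℝ :=
  c₁ • (oddShift f x - oddShiftAdj f x) + c₂ • oddShiftZero f x

/-- The norm of `L²(W)` for a `2 × 2` matrix weight on `[0,1)`. -/
def weightedNorm (W : ℝ → Matrix (Fin 2) (Fin 2) ℝ) (f : ℝ → Fin 2 → ℝ) : ENNReal :=
  (∫⁻ x in Set.Ico (0 : ℝ) 1, ENNReal.ofReal ((W x *ᵥ f x) ⬝ᵥ f x)) ^ (1 / 2 : ℝ)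

/-! ### The weight: eigenvalues

The averages of `W⁻¹` and `W` over a dyadic interval are tracked in the form
`⟨W⁻¹⟩ = α a a* + β b b*` and `⟨W⟩ = β♯ a a* + α♯ b b*`, with an orthonormal basis `a, b`. -/

/-- The four eigenvalues `α, β, α♯, β♯`. -/
structure Eigen where
  al : ℝ
  be : ℝ
  alS : ℝ
  beS : ℝ

/-- Rotation parameter `δ = q (β/α)^{1/2}` with `q = 0.1`. -/
def Eigen.delta (σ : Eigen) : ℝ := (1 / 10) * √(σ.be / σ.al)

/-- Eigenvalues after the rotation. -/
def Eigen.rotate (σ : Eigen) : Eigen where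
  al := (σ.al - σ.delta ^ 2 * σ.be) / (1 - σ.delta ^ 2)
  be := (σ.be - σ.delta ^ 2 * σ.al) / (1 - σ.delta ^ 2)
  alS := (σ.alS - σ.delta ^ 2 * σ.beS) / (1 - σ.delta ^ 2)
  beS := (σ.beS - σ.delta ^ 2 * σ.alS) / (1 - σ.delta ^ 2)

/-- Stretching parameter `r = 2 - 1/Q`. -/
def stretchR (Q : ℝ) : ℝ := 2 - 1 / Q

/-- `s = α β♯ / Q` (applied to rotated eigenvalues). -/
def Eigen.s (Q : ℝ) (σ : Eigen) : ℝ := σ.al * σ.beS / Q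

/-- Stretching, right child: `(x, y) ↦ (r x, y / (s r))` for `(x, y) = (α, β♯), (α♯, β)`. -/
def Eigen.stretchRight (Q : ℝ) (σ : Eigen) : Eigen where
  al := stretchR Q * σ.al
  be := σ.be / (σ.s Q * stretchR Q)
  alS := stretchR Q * σ.alS
  beS := σ.beS / (σ.s Q * stretchR Q)

/-- Stretching, left child: `(x, y) ↦ ((2 - r) x, (2 - 1 / (s r)) y)`. -/
def Eigen.stretchLeft (Q : ℝ) (σ : Eigen) : Eigen where
  al := (2 - stretchR Q) * σ.al
  be := (2 - 1 / (σ.s Q * stretchR Q)) * σ.be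
  alS := (2 - stretchR Q) * σ.alS
  beS := (2 - 1 / (σ.s Q * stretchR Q)) * σ.beS

/-- Eigenvalues on the two children (`ε = 1` right, `ε = -1` left) of an interval on which the
process is terminated.  In the basis normalizing `w = ⟨W⟩` to the identity one has
`W = 1 ± Δ` on the children, with `Δ ≥ 0` and `Δ² = 1 - v⁻¹`, `v = ⟨W⁻¹⟩`; both are diagonal in
the basis `a, b`.  On each child `⟨W⁻¹⟩ = ⟨W⟩⁻¹`. -/
def Eigen.fill (ε : ℝ) (σ : Eigen) : Eigen where
  al := (σ.beS * (1 + ε * √(1 - 1 / (σ.al * σ.beS))))⁻¹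
  be := (σ.alS * (1 + ε * √(1 - 1 / (σ.alS * σ.be))))⁻¹
  alS := σ.alS * (1 + ε * √(1 - 1 / (σ.alS * σ.be)))
  beS := σ.beS * (1 + ε * √(1 - 1 / (σ.al * σ.beS)))

/-- Eigenvalues `α_n, β_n, α_n♯, β_n♯` on the stopping intervals of generation `n`, with
`α₀ β₀♯ = α₀♯ β₀ = Q`. -/
def stopEigen (Q α₀ β₀ : ℝ) : ℕ → Eigen
  | 0 => ⟨α₀, β₀, Q / β₀, Q / α₀⟩
  | n + 1 => (stopEigen Q α₀ β₀ n).rotate.stretchRight Q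

/-! ### The weight: the martingale on the dyadic tree -/

/-- Role of a dyadic interval in the construction. -/
inductive Role where
  /-- stopping interval of generation `n` -/
  | stopping (n : ℕ)
  /-- child of a stopping interval of generation `n` -/
  | rotated (n : ℕ)
  /-- interval on which the process is terminated: left child of a `rotated` interval -/
  | terminal
  /-- interval on which `W` is constant -/
  | const

/-- Data attached to a dyadic interval: its role, and the eigenvalues and the common orthonormal
eigenbasis of the averages of `W⁻¹` and `W`. -/
structure Node where
  role : Role
  eig : Eigen
  a : Fin 2 → ℝ
  b : Fin 2 → ℝ

/-- `⟨W⟩ = β♯ a a* + α♯ b b*`. -/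
def Node.avgW (ν : Node) : Matrix (Fin 2) (Fin 2) ℝ :=
  ν.eig.beS • Matrix.vecMulVec ν.a ν.a + ν.eig.alS • Matrix.vecMulVec ν.b ν.b

/-- The right (`ε = 1`) and left (`ε = -1`) child of an interval.  The stopping intervals of
generation `N` are treated like terminal intervals. -/
def Node.child (Q α₀ β₀ : ℝ) (N : ℕ) (ν : Node) (ε : ℝ) : Node :=
  match ν.role with
  | .stopping n =>
      if n < N then
        { role := .rotated n
          eig := (stopEigen Q α₀ β₀ n).rotate
          a := (√(1 + (stopEigen Q α₀ β₀ n).delta ^ 2))⁻¹ •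
            (ν.a + (ε * (stopEigen Q α₀ β₀ n).delta) • ν.b)
          b := (√(1 + (stopEigen Q α₀ β₀ n).delta ^ 2))⁻¹ •
            (ν.b - (ε * (stopEigen Q α₀ β₀ n).delta) • ν.a) }
      else { ν with role := .const, eig := ν.eig.fill ε }
  | .rotated n =>
      if 0 < ε then { ν with role := .stopping (n + 1), eig := stopEigen Q α₀ β₀ (n + 1) }
      else { ν with role := .terminal, eig := ν.eig.stretchLeft Q }
  | .terminal => { ν with role := .const, eig := ν.eig.fill ε }
  | .const => ν

/-- The node of the dyadic interval of generation `k` and position `j`; the root `[0,1)` is the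
stopping interval of generation `0`. -/
def node (Q α₀ β₀ : ℝ) (a₀ b₀ : Fin 2 → ℝ) (N : ℕ) : ℕ → ℕ → Node
  | 0, _ => ⟨.stopping 0, stopEigen Q α₀ β₀ 0, a₀, b₀⟩
  | k + 1, j => (node Q α₀ β₀ a₀ b₀ N k (j / 2)).child Q α₀ β₀ N (if j % 2 = 1 then 1 else -1)

/-- The weight on `[0,1)`.  From generation `2N+1` on the martingale is stationary. -/
def weight (Q α₀ β₀ : ℝ) (a₀ b₀ : Fin 2 → ℝ) (N : ℕ) (x : ℝ) : Matrix (Fin 2) (Fin 2) ℝ :=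
  (node Q α₀ β₀ a₀ b₀ N (2 * N + 1) ⌊x * 2 ^ (2 * N + 1)⌋₊).avgW

/-- The function `W⁻¹ 1_{[0,1)} e`. -/
def testFun (W : ℝ → Matrix (Fin 2) (Fin 2) ℝ) (e : Fin 2 → ℝ) : ℝ → Fin 2 → ℝ :=
  (Set.Ico (0 : ℝ) 1).indicator fun x => (W x)⁻¹ *ᵥ e

/-- `‖T f‖_{L²(W)} ≳ Q^{3/2} ‖f‖_{L²(W)}` for the constructed weights `W` and `f = W⁻¹ 1_{[0,1)} e`
with `e = a₀` or `e = a₀ + b₀`: the implied constant `c` is absolute, `Q` is sufficiently large,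
`δ₀ = q (β₀/α₀)^{1/2}` is sufficiently small, and the construction is terminated after
sufficiently many steps. -/
def LowerBound (T : (ℝ → Fin 2 → ℝ) → ℝ → Fin 2 → ℝ) : Prop :=
  ∃ c > (0 : ℝ), ∃ Q₀ : ℝ, ∀ Q ≥ Q₀, ∃ δs > (0 : ℝ), ∀ α₀ β₀ : ℝ, 0 < α₀ → 0 < β₀ →
    (1 / 10) * √(β₀ / α₀) ≤ δs → ∃ N₀ : ℕ, ∀ N ≥ N₀, ∀ a₀ b₀ e : Fin 2 → ℝ,
      a₀ ⬝ᵥ a₀ = 1 → b₀ ⬝ᵥ b₀ = 1 → a₀ ⬝ᵥ b₀ = 0 → (e = a₀ ∨ e = a₀ + b₀) →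
        ENNReal.ofReal (c * Q ^ (3 / 2 : ℝ)) *
            weightedNorm (weight Q α₀ β₀ a₀ b₀ N) (testFun (weight Q α₀ β₀ a₀ b₀ N) e) ≤
          weightedNorm (weight Q α₀ β₀ a₀ b₀ N) (T (testFun (weight Q α₀ β₀ a₀ b₀ N) e))

end DyadicModel

end

noncomputable section
namespace DyadicModel

/-! ### Dyadic intervals and pointwise values of Haar functions -/

/-- `1` for odd positions (right children), `-1` for even positions (left children). -/
def sgn (j : ℕ) : ℝ := if j % 2 = 1 then 1 else -1

lemma sgn_two_mul (j : ℕ) : sgn (2 * j) = -1 := by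
  have h : ¬ (2 * j % 2 = 1) := by omega
  simp only [sgn, if_neg h]

lemma sgn_two_mul_add_one (j : ℕ) : sgn (2 * j + 1) = 1 := by
  have h : (2 * j + 1) % 2 = 1 := by omega
  simp only [sgn, if_pos h]

lemma nonneg_of_mem_dyadic {k j : ℕ} {x : ℝ} (hx : x ∈ dyadic k j) : 0 ≤ x :=
  le_trans (by positivity) hx.1

lemma mem_dyadic_iff {k j : ℕ} {x : ℝ} (hx : 0 ≤ x) : x ∈ dyadic k j ↔ ⌊x * 2 ^ k⌋₊ = j := by
  have h2 : (0 : ℝ) < 2 ^ k := by positivity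
  rw [Nat.floor_eq_iff (by positivity), dyadic, Set.mem_Ico, div_le_iff₀ h2, lt_div_iff₀ h2]

lemma floor_of_mem_dyadic {k j : ℕ} {x : ℝ} (hx : x ∈ dyadic k j) : ⌊x * 2 ^ k⌋₊ = j :=
  (mem_dyadic_iff (nonneg_of_mem_dyadic hx)).1 hx

lemma floor_pow_succ_div_two (k : ℕ) (x : ℝ) : ⌊x * 2 ^ (k + 1)⌋₊ / 2 = ⌊x * 2 ^ k⌋₊ := by
  rw [← Nat.floor_div_ofNat]
  congr 1
  rw [pow_succ]
  ring_nf

lemma dyadic_union (k j : ℕ) : dyadic (k + 1) (2 * j) ∪ dyadic (k + 1) (2 * j + 1) = dyadic k j := by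
  have h1 : ((2 * j : ℕ) : ℝ) / 2 ^ (k + 1) = (j : ℝ) / 2 ^ k := by
    push_cast; field_simp; ring
  have h2 : (((2 * j + 1 : ℕ) : ℝ) + 1) / 2 ^ (k + 1) = ((j : ℝ) + 1) / 2 ^ k := by
    push_cast; field_simp; ring
  have h3 : ((2 * j + 1 : ℕ) : ℝ) = ((2 * j : ℕ) : ℝ) + 1 := by push_cast; ring
  unfold dyadic
  rw [h2, h3, Set.Ico_union_Ico_eq_Ico, h1]
  · gcongr; linarith
  · rw [← h2]; gcongr; linarith

lemma dyadic_disjoint (k : ℕ) {i j : ℕ} (hij : i ≠ j) : Disjoint (dyadic k i) (dyadic k j) := by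
  rw [Set.disjoint_left]
  intro x hi hj
  exact hij ((floor_of_mem_dyadic hi).symm.trans (floor_of_mem_dyadic hj))

lemma measurableSet_dyadic (k j : ℕ) : MeasurableSet (dyadic k j) := measurableSet_Ico

lemma volume_dyadic (k j : ℕ) : volume (dyadic k j) = ENNReal.ofReal ((2 ^ k)⁻¹) := by
  rw [dyadic, Real.volume_Ico]
  congr 1
  field_simp
  ring

lemma dyadic_zero_zero : dyadic 0 0 = Set.Ico 0 1 := by simp [dyadic]

lemma floor_lt_of_mem_Ico {x : ℝ} (hx : x ∈ Set.Ico (0 : ℝ) 1) (k : ℕ) :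
    ⌊x * 2 ^ k⌋₊ < 2 ^ k := by
  rw [Nat.floor_lt (by have := hx.1; positivity)]
  push_cast
  have h2 : (0 : ℝ) < 2 ^ k := by positivity
  nlinarith [hx.2]

lemma dyadic_subset {k j : ℕ} (hj : j < 2 ^ k) : dyadic k j ⊆ Set.Ico 0 1 := by
  intro x hx
  refine ⟨nonneg_of_mem_dyadic hx, hx.2.trans_le ?_⟩
  rw [div_le_one (by positivity)]
  exact_mod_cast hj

lemma haar_apply (k j : ℕ) {x : ℝ} (hx : 0 ≤ x) :
    haar k j x = if ⌊x * 2 ^ k⌋₊ = j then √(2 ^ k) * sgn ⌊x * 2 ^ (k + 1)⌋₊ else 0 := by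
  have h := floor_pow_succ_div_two k x
  classical
  unfold haar sgn
  simp only [Set.indicator_apply, mem_dyadic_iff hx, Pi.one_apply]
  split_ifs <;> first | omega | simp

/-! ### Lower integrals along the dyadic tree -/

lemma lintegral_dyadic_add (φ : ℝ → ENNReal) (k j : ℕ) :
    ∫⁻ x in dyadic k j, φ x =
      (∫⁻ x in dyadic (k + 1) (2 * j), φ x) + ∫⁻ x in dyadic (k + 1) (2 * j + 1), φ x := by
  rw [← dyadic_union k j,
    lintegral_union (measurableSet_dyadic _ _) (dyadic_disjoint _ (by omega))]

lemma lintegral_dyadic_const {φ : ℝ → ENNReal} {k j : ℕ} {v : ENNReal}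
    (h : ∀ x ∈ dyadic k j, φ x = v) :
    ∫⁻ x in dyadic k j, φ x = v * ENNReal.ofReal ((2 ^ k)⁻¹) := by
  rw [setLIntegral_congr_fun (measurableSet_dyadic k j) h, setLIntegral_const, volume_dyadic]


/-! ### Eigenvalues on the stopping intervals -/

/-- The eigenvalues are positive, `α β♯ = α♯ β = Q` and `β ≤ α`. -/
structure Eigen.Balanced (Q : ℝ) (σ : Eigen) : Prop where
  al_pos : 0 < σ.al
  be_pos : 0 < σ.be
  be_le_al : σ.be ≤ σ.al
  alS_eq : σ.alS = Q / σ.be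
  beS_eq : σ.beS = Q / σ.al

/-- The factor `α̃ / α`. -/
def Eigen.factor (σ : Eigen) : ℝ := (1 - (σ.be / σ.al) ^ 2 / 100) / (1 - σ.be / σ.al / 100)

/-- The factor `β̃ / β`. -/
def Eigen.cofactor (σ : Eigen) : ℝ := (99 / 100) / (1 - σ.be / σ.al / 100)

namespace Eigen.Balanced

variable {Q : ℝ} {σ : Eigen} (h : σ.Balanced Q)

include h

lemma ratio_pos : 0 < σ.be / σ.al := div_pos h.be_pos h.al_pos

lemma ratio_le_one : σ.be / σ.al ≤ 1 := (div_le_one h.al_pos).2 h.be_le_al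

lemma delta_sq : σ.delta ^ 2 = σ.be / σ.al / 100 := by
  rw [Eigen.delta, mul_pow, Real.sq_sqrt h.ratio_pos.le]; ring

omit h in
lemma delta_nonneg (σ : Eigen) : 0 ≤ σ.delta := by unfold Eigen.delta; positivity

lemma delta_sq_le : σ.delta ^ 2 ≤ 1 / 100 := by
  rw [h.delta_sq]; linarith [h.ratio_le_one]

lemma al_mul_delta : σ.al * σ.delta = √(σ.al * σ.be) / 10 := by
  have : σ.al * √(σ.be / σ.al) = √(σ.al * σ.be) := by
    rw [eq_comm, Real.sqrt_eq_iff_mul_self_eq (mul_pos h.al_pos h.be_pos).le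
      (mul_nonneg h.al_pos.le (Real.sqrt_nonneg _))]
    have := Real.mul_self_sqrt h.ratio_pos.le
    have e : σ.al * σ.be = σ.al * σ.al * (σ.be / σ.al) := by
      have := h.al_pos; field_simp
    rw [mul_mul_mul_comm, this, e]
  rw [Eigen.delta, ← this]; ring

lemma one_le_factor : 1 ≤ σ.factor := by
  have h1 := h.ratio_pos; have h2 := h.ratio_le_one
  rw [Eigen.factor, le_div_iff₀ (by linarith)]; nlinarith

lemma factor_le : σ.factor ≤ 100 / 99 := by
  have h1 := h.ratio_pos; have h2 := h.ratio_le_one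
  rw [Eigen.factor, div_le_iff₀ (by linarith)]; nlinarith

lemma le_cofactor : 99 / 100 ≤ σ.cofactor := by
  have h1 := h.ratio_pos; have h2 := h.ratio_le_one
  rw [Eigen.cofactor, le_div_iff₀ (by linarith)]; nlinarith

lemma cofactor_le : σ.cofactor ≤ 1 := by
  have h1 := h.ratio_pos; have h2 := h.ratio_le_one
  rw [Eigen.cofactor, div_le_iff₀ (by linarith)]; nlinarith

lemma rotate_al : σ.rotate.al = σ.factor * σ.al := by
  have h0 := h.al_pos; have h2 := h.ratio_le_one
  have : (1 - σ.be / σ.al / 100) ≠ 0 := by intro h; linarith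
  simp only [Eigen.rotate, h.delta_sq, Eigen.factor]
  rw [div_mul_eq_mul_div]; field_simp

lemma rotate_be : σ.rotate.be = σ.cofactor * σ.be := by
  have h0 := h.al_pos
  simp only [Eigen.rotate, h.delta_sq, Eigen.cofactor]
  rw [div_mul_eq_mul_div]; field_simp; ring

lemma rotate_alS : σ.rotate.alS = σ.factor * σ.alS := by
  have h0 := h.al_pos; have h1 := h.be_pos
  simp only [Eigen.rotate, h.delta_sq, Eigen.factor]
  rw [div_mul_eq_mul_div]; rw [h.alS_eq, h.beS_eq]; field_simp

lemma rotate_beS : σ.rotate.beS = σ.cofactor * σ.beS := by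
  have h0 := h.al_pos; have h1 := h.be_pos
  simp only [Eigen.rotate, h.delta_sq, Eigen.cofactor]
  rw [div_mul_eq_mul_div]; rw [h.alS_eq, h.beS_eq]; field_simp; ring

lemma rotate_s (hQ : 2 ≤ Q) : σ.rotate.s Q = σ.factor * σ.cofactor := by
  have h0 := h.al_pos
  rw [Eigen.s, h.rotate_al, h.rotate_beS, h.beS_eq]; field_simp

lemma rotate_be_le_al : σ.rotate.be ≤ σ.rotate.al := by
  rw [h.rotate_al, h.rotate_be]
  have := h.al_pos; have := h.be_pos
  nlinarith [h.one_le_factor, h.cofactor_le, h.be_le_al]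

omit h in
lemma stretchR_ge (hQ : 2 ≤ Q) : 3 / 2 ≤ stretchR Q := by
  have : 1 / Q ≤ 1 / 2 := one_div_le_one_div_of_le (by norm_num) hQ
  rw [stretchR]; linarith

lemma next_al : (σ.rotate.stretchRight Q).al = stretchR Q * (σ.factor * σ.al) := by
  rw [Eigen.stretchRight, h.rotate_al]

lemma next_be (hQ : 2 ≤ Q) :
    (σ.rotate.stretchRight Q).be = σ.be / (stretchR Q * σ.factor) := by
  have h1 := h.one_le_factor; have h2 := h.le_cofactor; have := stretchR_ge hQ
  simp only [Eigen.stretchRight, h.rotate_be, h.rotate_s hQ]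
  field_simp

lemma next (hQ : 2 ≤ Q) : (σ.rotate.stretchRight Q).Balanced Q := by
  have h1 := h.one_le_factor; have h2 := h.le_cofactor; have h3 := stretchR_ge hQ
  have h4 := h.al_pos; have h5 := h.be_pos
  refine ⟨?_, ?_, ?_, ?_, ?_⟩
  · rw [h.next_al]; positivity
  · rw [h.next_be hQ]; positivity
  · rw [h.next_al, h.next_be hQ]
    calc σ.be / (stretchR Q * σ.factor) ≤ σ.be := div_le_self h5.le (by nlinarith)
      _ ≤ σ.al := h.be_le_al
      _ ≤ σ.factor * σ.al := by nlinarith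
      _ ≤ _ := le_mul_of_one_le_left (by positivity) (by linarith)
  · rw [h.next_be hQ]
    simp only [Eigen.stretchRight, h.rotate_alS, h.alS_eq]
    field_simp
  · rw [h.next_al]
    simp only [Eigen.stretchRight, h.rotate_beS, h.beS_eq, h.rotate_s hQ]
    field_simp

lemma next_al_mul_be (hQ : 2 ≤ Q) :
    (σ.rotate.stretchRight Q).al * (σ.rotate.stretchRight Q).be = σ.al * σ.be := by
  have h1 := h.one_le_factor; have h3 := stretchR_ge hQ
  rw [h.next_al, h.next_be hQ]; field_simp

lemma next_ratio_le (hQ : 2 ≤ Q) :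
    (σ.rotate.stretchRight Q).be / (σ.rotate.stretchRight Q).al ≤ 4 / 9 * (σ.be / σ.al) := by
  have h1 := h.one_le_factor; have h3 := stretchR_ge hQ
  have h4 := h.al_pos; have h5 := h.be_pos
  rw [h.next_al, h.next_be hQ]
  have h6 : 3 / 2 ≤ stretchR Q * σ.factor := by nlinarith
  have : σ.be / (stretchR Q * σ.factor) / (stretchR Q * (σ.factor * σ.al)) =
      (1 / (stretchR Q * σ.factor) ^ 2) * (σ.be / σ.al) := by field_simp
  rw [this]
  refine mul_le_mul_of_nonneg_right ?_ h.ratio_pos.le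
  rw [div_le_iff₀ (by positivity)]
  nlinarith

lemma one_div_s_mul_le (hQ : 2 ≤ Q) : 1 / (σ.rotate.s Q * stretchR Q) ≤ 7 / 10 := by
  have h1 := h.one_le_factor; have h2 := h.le_cofactor; have h3 := stretchR_ge hQ
  rw [h.rotate_s hQ]
  have h5 : 99 / 100 ≤ σ.factor * σ.cofactor := by nlinarith
  rw [div_le_iff₀ (by positivity)]
  nlinarith

lemma one_div_s_mul_pos (hQ : 2 ≤ Q) : 0 < 1 / (σ.rotate.s Q * stretchR Q) := by
  have h1 := h.one_le_factor; have h2 := h.le_cofactor; have h3 := stretchR_ge hQ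
  rw [h.rotate_s hQ]; positivity

/-! Eigenvalues on terminal intervals. -/

omit h in
lemma stretchLeft_al (Q : ℝ) (σ : Eigen) : (σ.rotate.stretchLeft Q).al = σ.rotate.al / Q := by
  simp only [Eigen.stretchLeft, stretchR]; ring

lemma stretchLeft_alS (hQ : 2 ≤ Q) : (σ.rotate.stretchLeft Q).alS = σ.rotate.al / (σ.al * σ.be) := by
  have h4 := h.al_pos; have h5 := h.be_pos
  simp only [Eigen.stretchLeft, stretchR, h.rotate_alS, h.rotate_al, h.alS_eq]
  field_simp; ring

lemma stretchLeft_pos (hQ : 2 ≤ Q) :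
    0 < (σ.rotate.stretchLeft Q).al ∧ 0 < (σ.rotate.stretchLeft Q).be ∧
      0 < (σ.rotate.stretchLeft Q).alS ∧ 0 < (σ.rotate.stretchLeft Q).beS := by
  have h1 := h.one_le_factor; have h2 := h.le_cofactor
  have h4 := h.al_pos; have h5 := h.be_pos; have h6 := h.one_div_s_mul_le hQ
  refine ⟨?_, ?_, ?_, ?_⟩
  · rw [stretchLeft_al, h.rotate_al]; positivity
  · simp only [Eigen.stretchLeft]; rw [h.rotate_be]
    exact mul_pos (by linarith) (by positivity)
  · rw [h.stretchLeft_alS hQ, h.rotate_al]; positivity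
  · simp only [Eigen.stretchLeft]; rw [h.rotate_beS, h.beS_eq]
    exact mul_pos (by linarith) (by positivity)

lemma stretchLeft_al_mul_beS (hQ : 2 ≤ Q) :
    (σ.rotate.stretchLeft Q).al * (σ.rotate.stretchLeft Q).beS =
      2 * (σ.factor * σ.cofactor) - 1 / stretchR Q := by
  have h1 := h.one_le_factor; have h2 := h.le_cofactor; have h3 := stretchR_ge hQ
  have h4 := h.al_pos
  rw [stretchLeft_al, h.rotate_al]
  simp only [Eigen.stretchLeft]
  rw [h.rotate_beS, h.beS_eq, h.rotate_s hQ]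
  field_simp

lemma stretchLeft_alS_mul_be (hQ : 2 ≤ Q) :
    (σ.rotate.stretchLeft Q).alS * (σ.rotate.stretchLeft Q).be =
      2 * (σ.factor * σ.cofactor) - 1 / stretchR Q := by
  have h1 := h.one_le_factor; have h2 := h.le_cofactor; have h3 := stretchR_ge hQ
  have h4 := h.al_pos; have h5 := h.be_pos
  rw [h.stretchLeft_alS hQ, h.rotate_al]
  simp only [Eigen.stretchLeft]
  rw [h.rotate_be, h.rotate_s hQ]
  field_simp

lemma one_le_stretchLeft (hQ : 2 ≤ Q) : 1 ≤ 2 * (σ.factor * σ.cofactor) - 1 / stretchR Q := by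
  have h1 := h.one_le_factor; have h2 := h.le_cofactor; have h3 := stretchR_ge hQ
  have : 1 / stretchR Q ≤ 1 / (3 / 2) := one_div_le_one_div_of_le (by norm_num) h3
  nlinarith

end Eigen.Balanced

lemma stopEigen_balanced {Q α₀ β₀ : ℝ} (hQ : 2 ≤ Q) (hβ : 0 < β₀) (hαβ : β₀ ≤ α₀) (n : ℕ) :
    (stopEigen Q α₀ β₀ n).Balanced Q := by
  induction n with
  | zero => exact ⟨hβ.trans_le hαβ, hβ, hαβ, rfl, rfl⟩
  | succ n ih => exact ih.next hQ

lemma stopEigen_al_mul_be {Q α₀ β₀ : ℝ} (hQ : 2 ≤ Q) (hβ : 0 < β₀) (hαβ : β₀ ≤ α₀) (n : ℕ) :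
    (stopEigen Q α₀ β₀ n).al * (stopEigen Q α₀ β₀ n).be = α₀ * β₀ := by
  induction n with
  | zero => rfl
  | succ n ih =>
    rw [← ih]; exact (stopEigen_balanced hQ hβ hαβ n).next_al_mul_be hQ

lemma stopEigen_ratio_le {Q α₀ β₀ : ℝ} (hQ : 2 ≤ Q) (hβ : 0 < β₀) (hαβ : β₀ ≤ α₀) (n : ℕ) :
    (stopEigen Q α₀ β₀ n).be / (stopEigen Q α₀ β₀ n).al ≤ (4 / 9) ^ n := by
  induction n with
  | zero => simpa using (stopEigen_balanced hQ hβ hαβ 0).ratio_le_one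
  | succ n ih =>
    refine ((stopEigen_balanced hQ hβ hαβ n).next_ratio_le hQ).trans ?_
    rw [pow_succ']; gcongr

lemma le_stopEigen_al {Q α₀ β₀ : ℝ} (hQ : 2 ≤ Q) (hβ : 0 < β₀) (hαβ : β₀ ≤ α₀) (n : ℕ) :
    stretchR Q ^ n * α₀ ≤ (stopEigen Q α₀ β₀ n).al := by
  have h3 := Eigen.Balanced.stretchR_ge hQ
  induction n with
  | zero => simp [stopEigen]
  | succ n ih =>
    have h := stopEigen_balanced hQ hβ hαβ n
    change _ ≤ ((stopEigen Q α₀ β₀ n).rotate.stretchRight Q).al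
    rw [h.next_al, pow_succ', mul_assoc]
    refine mul_le_mul_of_nonneg_left (ih.trans ?_) (by linarith)
    nlinarith [h.al_pos, h.one_le_factor]


/-! ### Orthonormal bases of the plane -/

/-- `a, b` is an orthonormal basis of the plane. -/
structure OrthoPair (a b : Fin 2 → ℝ) : Prop where
  aa : a ⬝ᵥ a = 1
  bb : b ⬝ᵥ b = 1
  ab : a ⬝ᵥ b = 0

namespace OrthoPair

variable {a b : Fin 2 → ℝ} (h : OrthoPair a b)

include h

lemma ba : b ⬝ᵥ a = 0 := by rw [dotProduct_comm, h.ab]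

lemma vecMulVec_add : Matrix.vecMulVec a a + Matrix.vecMulVec b b = 1 := by
  have h1 : (!![a 0, a 1; b 0, b 1] : Matrix (Fin 2) (Fin 2) ℝ) * !![a 0, b 0; a 1, b 1] = 1 := by
    have h1 := h.aa; have h2 := h.bb; have h3 := h.ab; have h4 := h.ba
    simp only [dotProduct, Fin.sum_univ_two] at h1 h2 h3 h4
    simp [Matrix.one_fin_two, h1, h2, h3, h4]
  have h2 := mul_eq_one_comm.1 h1
  rw [← h2]
  ext i j
  fin_cases i <;> fin_cases j <;> simp [Matrix.vecMulVec_apply, Matrix.mul_apply]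

lemma rotate (δ : ℝ) :
    OrthoPair ((√(1 + δ ^ 2))⁻¹ • (a + δ • b)) ((√(1 + δ ^ 2))⁻¹ • (b - δ • a)) := by
  have hc : (√(1 + δ ^ 2))⁻¹ * (√(1 + δ ^ 2))⁻¹ * (1 + δ ^ 2) = 1 := by
    have h0 : 0 < 1 + δ ^ 2 := by positivity
    rw [← mul_inv, Real.mul_self_sqrt h0.le]; field_simp
  constructor <;>
    simp only [smul_dotProduct, dotProduct_smul, add_dotProduct, dotProduct_add, sub_dotProduct,
      dotProduct_sub, smul_eq_mul, h.aa, h.bb, h.ab, h.ba]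
  · linear_combination hc
  · linear_combination hc
  · ring

end OrthoPair

/-! ### Nodes of the tree -/

/-- `⟨W⁻¹⟩ e = α (a, e) a + β (b, e) b`. -/
def Node.invVec (ν : Node) (e : Fin 2 → ℝ) : Fin 2 → ℝ :=
  (ν.eig.al * (ν.a ⬝ᵥ e)) • ν.a + (ν.eig.be * (ν.b ⬝ᵥ e)) • ν.b

/-- Positive eigenvalues with `α β♯ ≥ 1` and `α♯ β ≥ 1`. -/
structure Eigen.Fillable (σ : Eigen) : Prop where
  alS_pos : 0 < σ.alS
  beS_pos : 0 < σ.beS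
  one_le_al : 1 ≤ σ.al * σ.beS
  one_le_be : 1 ≤ σ.alS * σ.be

lemma Eigen.Balanced.fillable {Q : ℝ} {σ : Eigen} (h : σ.Balanced Q) (hQ : 2 ≤ Q) : σ.Fillable := by
  have h1 := h.al_pos; have h2 := h.be_pos
  refine ⟨?_, ?_, ?_, ?_⟩
  · rw [h.alS_eq]; positivity
  · rw [h.beS_eq]; positivity
  · rw [h.beS_eq]; field_simp; linarith
  · rw [h.alS_eq]; field_simp; linarith

lemma Eigen.Balanced.fillable_stretchLeft {Q : ℝ} {σ : Eigen} (h : σ.Balanced Q) (hQ : 2 ≤ Q) :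
    (σ.rotate.stretchLeft Q).Fillable := by
  obtain ⟨h1, h2, h3, h4⟩ := h.stretchLeft_pos hQ
  refine ⟨h3, h4, ?_, ?_⟩
  · rw [h.stretchLeft_al_mul_beS hQ]; exact h.one_le_stretchLeft hQ
  · rw [h.stretchLeft_alS_mul_be hQ]; exact h.one_le_stretchLeft hQ

/-- Role-dependent constraints on a node of generation `k`. -/
def RoleInv (Q α₀ β₀ : ℝ) (N k : ℕ) : Role → Eigen → Prop
  | .stopping n, σ => k = 2 * n ∧ n ≤ N ∧ σ = stopEigen Q α₀ β₀ n
  | .rotated n, σ => k = 2 * n + 1 ∧ n < N ∧ σ = (stopEigen Q α₀ β₀ n).rotate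
  | .terminal, σ => k ≤ 2 * N ∧ σ.Fillable
  | .const, σ => 0 < σ.alS ∧ 0 < σ.beS ∧ σ.al = σ.beS⁻¹ ∧ σ.be = σ.alS⁻¹

/-- Invariants of the nodes of generation `k`. -/
structure Node.Valid (Q α₀ β₀ : ℝ) (N k : ℕ) (ν : Node) : Prop where
  ortho : OrthoPair ν.a ν.b
  role : RoleInv Q α₀ β₀ N k ν.role ν.eig

lemma fill_aux {A B : ℝ} (hB : 0 < B) (hAB : 1 ≤ A * B) :
    0 < 1 - √(1 - 1 / (A * B)) ∧ 0 < 1 + √(1 - 1 / (A * B)) ∧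
      (B * (1 + √(1 - 1 / (A * B))))⁻¹ + (B * (1 + -1 * √(1 - 1 / (A * B))))⁻¹ = 2 * A ∧
      (B * (1 + √(1 - 1 / (A * B))))⁻¹ - (B * (1 + -1 * √(1 - 1 / (A * B))))⁻¹ =
        -(2 * (√(1 - 1 / (A * B)) * A)) := by
  have hAB0 : 0 < A * B := by linarith
  have hA : 0 < A := pos_of_mul_pos_left hAB0 hB.le
  have h1 : 1 / (A * B) ≤ 1 := (div_le_one hAB0).2 hAB
  have h2 : 0 < 1 / (A * B) := by positivity
  have h3 := Real.mul_self_sqrt (sub_nonneg.2 h1)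
  have ht0 := Real.sqrt_nonneg (1 - 1 / (A * B))
  set t := √(1 - 1 / (A * B)) with ht
  have ht1 : t < 1 := by nlinarith
  have h4 : A * B * (1 - t) * (1 + t) = 1 := by
    have : (1 - t) * (1 + t) = 1 / (A * B) := by linarith
    rw [mul_assoc, this]; field_simp
  have h5 : (1 - t) ≠ 0 := by linarith
  have h6 : (1 + t) ≠ 0 := by linarith
  have e1 : (B * (1 + t))⁻¹ = A * (1 - t) := by
    apply inv_eq_of_mul_eq_one_right; linarith
  have e2 : (B * (1 + -1 * t))⁻¹ = A * (1 + t) := by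
    apply inv_eq_of_mul_eq_one_right; linarith
  refine ⟨by linarith, by linarith, ?_, ?_⟩ <;> rw [e1, e2] <;> ring

lemma roleInv_fill {Q α₀ β₀ : ℝ} {N k : ℕ} {σ : Eigen} (h : σ.Fillable) {ε : ℝ}
    (hε : ε = 1 ∨ ε = -1) : RoleInv Q α₀ β₀ N k .const (σ.fill ε) := by
  obtain ⟨h1, h2, -, -⟩ := fill_aux h.beS_pos h.one_le_al
  have h5 : 1 ≤ σ.be * σ.alS := by rw [mul_comm]; exact h.one_le_be
  obtain ⟨h3, h4, -, -⟩ := fill_aux h.alS_pos h5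
  rw [mul_comm σ.be] at h3 h4
  refine ⟨?_, ?_, rfl, rfl⟩
  · refine mul_pos h.alS_pos ?_
    rcases hε with rfl | rfl <;> linarith
  · refine mul_pos h.beS_pos ?_
    rcases hε with rfl | rfl <;> linarith

section

variable {Q α₀ β₀ : ℝ} {N k : ℕ} {ν : Node}

lemma Node.Valid.child (hQ : 2 ≤ Q) (hβ : 0 < β₀) (hαβ : β₀ ≤ α₀)
    (h : ν.Valid Q α₀ β₀ N k) {ε : ℝ} (hε : ε = 1 ∨ ε = -1) :
    (ν.child Q α₀ β₀ N ε).Valid Q α₀ β₀ N (k + 1) := by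
  obtain ⟨role, σ, a, b⟩ := ν
  obtain ⟨ho, hr⟩ := h
  cases role with
  | stopping n =>
    obtain ⟨h1, h2, h3⟩ := hr
    dsimp only at h1 h2 h3
    subst h1 h3
    by_cases hn : n < N
    · simp only [Node.child, if_pos hn]
      refine ⟨?_, by omega, hn, rfl⟩
      have := ho.rotate (ε * (stopEigen Q α₀ β₀ n).delta)
      have e : (ε * (stopEigen Q α₀ β₀ n).delta) ^ 2 = (stopEigen Q α₀ β₀ n).delta ^ 2 := by
        rcases hε with rfl | rfl <;> ring
      rwa [e] at this
    · simp only [Node.child, if_neg hn]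
      exact ⟨ho, roleInv_fill ((stopEigen_balanced hQ hβ hαβ n).fillable hQ) hε⟩
  | rotated n =>
    obtain ⟨h1, h2, h3⟩ := hr
    dsimp only at h1 h2 h3
    subst h1 h3
    rcases hε with rfl | rfl
    · simp only [Node.child, if_pos zero_lt_one]
      exact ⟨ho, by omega, h2, rfl⟩
    · have : ¬ ((0 : ℝ) < -1) := by norm_num
      simp only [Node.child, if_neg this]
      exact ⟨ho, by omega, (stopEigen_balanced hQ hβ hαβ n).fillable_stretchLeft hQ⟩
  | terminal =>
    obtain ⟨h1, h2⟩ := hr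
    exact ⟨ho, roleInv_fill h2 hε⟩
  | const => exact ⟨ho, hr⟩

lemma Node.Valid.role_const (h : ν.Valid Q α₀ β₀ N k) (hk : 2 * N + 1 ≤ k) : ν.role = .const := by
  obtain ⟨role, σ, a, b⟩ := ν
  obtain ⟨ho, hr⟩ := h
  cases role with
  | stopping n => obtain ⟨h1, h2, h3⟩ := hr; omega
  | rotated n => obtain ⟨h1, h2, h3⟩ := hr; omega
  | terminal => obtain ⟨h1, h2⟩ := hr; omega
  | const => rfl

lemma child_of_const (h : ν.role = .const) (ε : ℝ) : ν.child Q α₀ β₀ N ε = ν := by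
  obtain ⟨role, σ, a, b⟩ := ν
  dsimp only at h
  subst h
  rfl

/-- Half of the difference of the averages of `W⁻¹ e` over the two children. -/
def Node.halfDiff (Q α₀ β₀ : ℝ) (N : ℕ) (ν : Node) (e : Fin 2 → ℝ) : Fin 2 → ℝ :=
  (1 / 2 : ℝ) • ((ν.child Q α₀ β₀ N 1).invVec e - (ν.child Q α₀ β₀ N (-1)).invVec e)

lemma halfDiff_const (h : ν.role = .const) (e : Fin 2 → ℝ) : ν.halfDiff Q α₀ β₀ N e = 0 := by
  simp [Node.halfDiff, child_of_const h]

lemma invVec_fill {σ : Eigen} (h : σ.Fillable) (r r' : Role) (a b e : Fin 2 → ℝ) :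
    Node.invVec ⟨r, σ.fill 1, a, b⟩ e + Node.invVec ⟨r', σ.fill (-1), a, b⟩ e =
        (2 : ℝ) • Node.invVec ⟨r, σ, a, b⟩ e ∧
      (1 / 2 : ℝ) • (Node.invVec ⟨r, σ.fill 1, a, b⟩ e - Node.invVec ⟨r', σ.fill (-1), a, b⟩ e) =
        -((√(1 - 1 / (σ.al * σ.beS)) * σ.al * (a ⬝ᵥ e)) • a +
          (√(1 - 1 / (σ.alS * σ.be)) * σ.be * (b ⬝ᵥ e)) • b) := by
  obtain ⟨-, -, h1, h2⟩ := fill_aux h.beS_pos h.one_le_al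
  have h5 : 1 ≤ σ.be * σ.alS := by rw [mul_comm]; exact h.one_le_be
  obtain ⟨-, -, h3, h4⟩ := fill_aux h.alS_pos h5
  rw [mul_comm σ.be] at h3 h4
  simp only [Node.invVec, Eigen.fill, one_mul]
  generalize (σ.beS * (1 + √(1 - 1 / (σ.al * σ.beS))))⁻¹ = x1 at *
  generalize (σ.beS * (1 + -1 * √(1 - 1 / (σ.al * σ.beS))))⁻¹ = x2 at *
  generalize (σ.alS * (1 + √(1 - 1 / (σ.alS * σ.be))))⁻¹ = x3 at *
  generalize (σ.alS * (1 + -1 * √(1 - 1 / (σ.alS * σ.be))))⁻¹ = x4 at *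
  constructor
  · ext i
    simp only [Pi.add_apply, Pi.smul_apply, smul_eq_mul]
    linear_combination (a ⬝ᵥ e) * a i * h1 + (b ⬝ᵥ e) * b i * h3
  · ext i
    simp only [Pi.add_apply, Pi.sub_apply, Pi.neg_apply, Pi.smul_apply, smul_eq_mul]
    linear_combination (1 / 2) * (a ⬝ᵥ e) * a i * h2 + (1 / 2) * (b ⬝ᵥ e) * b i * h4

lemma Eigen.Balanced.inv_sqrt_sq (σ : Eigen) :
    (√(1 + σ.delta ^ 2))⁻¹ * (√(1 + σ.delta ^ 2))⁻¹ = 1 / (1 + σ.delta ^ 2) := by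
  have h0 : 0 < 1 + σ.delta ^ 2 := by positivity
  rw [← mul_inv, Real.mul_self_sqrt h0.le, one_div]

/-- The martingale property of the averages of `W⁻¹ e`. -/
lemma invVec_child_add (hQ : 2 ≤ Q) (hβ : 0 < β₀) (hαβ : β₀ ≤ α₀) (h : ν.Valid Q α₀ β₀ N k)
    (e : Fin 2 → ℝ) :
    (ν.child Q α₀ β₀ N 1).invVec e + (ν.child Q α₀ β₀ N (-1)).invVec e = (2 : ℝ) • ν.invVec e := by
  obtain ⟨role, σ, a, b⟩ := ν
  obtain ⟨ho, hr⟩ := h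
  cases role with
  | stopping n =>
    obtain ⟨h1, h2, h3⟩ := hr
    dsimp only at h1 h2 h3
    subst h1 h3
    have hb := stopEigen_balanced hQ hβ hαβ n
    set σ := stopEigen Q α₀ β₀ n with hσ
    by_cases hn : n < N
    · simp only [Node.child, if_pos hn, ← hσ, Node.invVec, smul_dotProduct, add_dotProduct,
        sub_dotProduct, smul_eq_mul, Eigen.rotate]
      have hc := Eigen.Balanced.inv_sqrt_sq σ
      have hd := hb.delta_sq_le
      generalize (√(1 + σ.delta ^ 2))⁻¹ = c at *
      have h0 : (1 + σ.delta ^ 2) ≠ 0 := by positivity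
      have h0' : (1 - σ.delta ^ 2) ≠ 0 := by linarith
      have e1 : c * c * ((σ.al - σ.delta ^ 2 * σ.be) / (1 - σ.delta ^ 2) +
          σ.delta ^ 2 * ((σ.be - σ.delta ^ 2 * σ.al) / (1 - σ.delta ^ 2))) = σ.al := by
        rw [hc]; field_simp; ring
      have e2 : c * c * ((σ.be - σ.delta ^ 2 * σ.al) / (1 - σ.delta ^ 2) +
          σ.delta ^ 2 * ((σ.al - σ.delta ^ 2 * σ.be) / (1 - σ.delta ^ 2))) = σ.be := by
        rw [hc]; field_simp; ring
      generalize (σ.al - σ.delta ^ 2 * σ.be) / (1 - σ.delta ^ 2) = A at *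
      generalize (σ.be - σ.delta ^ 2 * σ.al) / (1 - σ.delta ^ 2) = B at *
      ext i
      simp only [Pi.add_apply, Pi.sub_apply, Pi.smul_apply, smul_eq_mul]
      linear_combination 2 * (a ⬝ᵥ e) * a i * e1 + 2 * (b ⬝ᵥ e) * b i * e2
    · simp only [Node.child, if_neg hn]
      exact (invVec_fill (hb.fillable hQ) _ _ _ _ _).1
  | rotated n =>
    obtain ⟨h1, h2, h3⟩ := hr
    dsimp only at h1 h2 h3
    subst h1 h3
    have : ¬ ((0 : ℝ) < -1) := by norm_num
    simp only [Node.child, if_pos zero_lt_one, if_neg this, Node.invVec, stopEigen,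
      Eigen.stretchRight, Eigen.stretchLeft]
    rw [div_eq_mul_one_div]
    module
  | terminal =>
    obtain ⟨h1, h2⟩ := hr
    exact (invVec_fill h2 _ _ _ _ _).1
  | const => simp [Node.child, two_smul]

/-- Half-difference of the averages over the halves of a stopping interval. -/
lemma halfDiff_stopping {n : ℕ} (hn : n < N) (a b e : Fin 2 → ℝ) (τ : Eigen) :
    Node.halfDiff Q α₀ β₀ N ⟨.stopping n, τ, a, b⟩ e =
      ((stopEigen Q α₀ β₀ n).delta / (1 + (stopEigen Q α₀ β₀ n).delta ^ 2) *
        ((stopEigen Q α₀ β₀ n).rotate.al - (stopEigen Q α₀ β₀ n).rotate.be)) •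
        ((b ⬝ᵥ e) • a + (a ⬝ᵥ e) • b) := by
  set σ := stopEigen Q α₀ β₀ n with hσ
  simp only [Node.halfDiff, Node.child, if_pos hn, ← hσ, Node.invVec, smul_dotProduct,
    add_dotProduct, sub_dotProduct, smul_eq_mul]
  have hc := Eigen.Balanced.inv_sqrt_sq σ
  generalize (√(1 + σ.delta ^ 2))⁻¹ = c at *
  rw [div_eq_mul_one_div σ.delta, ← hc]
  module

/-- Half-difference of the averages over the halves of a rotated interval. -/
lemma halfDiff_rotated {n : ℕ} (a b e : Fin 2 → ℝ) :
    Node.halfDiff Q α₀ β₀ N ⟨.rotated n, (stopEigen Q α₀ β₀ n).rotate, a, b⟩ e =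
      ((stretchR Q - 1) * (stopEigen Q α₀ β₀ n).rotate.al * (a ⬝ᵥ e)) • a +
        ((1 / ((stopEigen Q α₀ β₀ n).rotate.s Q * stretchR Q) - 1) *
          (stopEigen Q α₀ β₀ n).rotate.be * (b ⬝ᵥ e)) • b := by
  have : ¬ ((0 : ℝ) < -1) := by norm_num
  simp only [Node.halfDiff, Node.child, if_pos zero_lt_one, if_neg this, Node.invVec, stopEigen,
    Eigen.stretchRight, Eigen.stretchLeft]
  rw [div_eq_mul_one_div (stopEigen Q α₀ β₀ n).rotate.be]
  module

/-- The parameter `Δ` on the terminal intervals of generation `n`. -/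
def fillParam (Q : ℝ) (σ : Eigen) : ℝ :=
  √(1 - 1 / ((σ.rotate.stretchLeft Q).alS * (σ.rotate.stretchLeft Q).be))

lemma fillParam_nonneg (Q : ℝ) (σ : Eigen) : 0 ≤ fillParam Q σ := Real.sqrt_nonneg _

lemma fillParam_le_one {Q : ℝ} {σ : Eigen} (hQ : 2 ≤ Q) (h : σ.Balanced Q) :
    fillParam Q σ ≤ 1 := by
  rw [fillParam, h.stretchLeft_alS_mul_be hQ]
  refine Real.sqrt_le_one.2 ?_
  have := h.one_le_stretchLeft hQ
  have : 0 < 1 / (2 * (σ.factor * σ.cofactor) - 1 / stretchR Q) := by positivity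
  linarith

/-- Half-difference of the averages over the halves of a terminal interval. -/
lemma halfDiff_terminal (hQ : 2 ≤ Q) {σ : Eigen} (h : σ.Balanced Q) (a b e : Fin 2 → ℝ) :
    Node.halfDiff Q α₀ β₀ N ⟨.terminal, σ.rotate.stretchLeft Q, a, b⟩ e =
      -((fillParam Q σ * (σ.rotate.al / Q) * (a ⬝ᵥ e)) • a +
        (fillParam Q σ * (σ.rotate.stretchLeft Q).be * (b ⬝ᵥ e)) • b) := by
  have := (invVec_fill (h.fillable_stretchLeft hQ) .const .const a b e).2
  rw [Eigen.Balanced.stretchLeft_al, ← Eigen.Balanced.stretchLeft_al, h.stretchLeft_al_mul_beS hQ,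
    ← h.stretchLeft_alS_mul_be hQ, Eigen.Balanced.stretchLeft_al] at this
  exact this

/-! ### The weight -/

lemma avgW_mulVec_dotProduct (ν : Node) (g : Fin 2 → ℝ) :
    (ν.avgW *ᵥ g) ⬝ᵥ g = ν.eig.beS * (ν.a ⬝ᵥ g) ^ 2 + ν.eig.alS * (ν.b ⬝ᵥ g) ^ 2 := by
  simp only [Node.avgW, Matrix.add_mulVec, Matrix.smul_mulVec, Matrix.vecMulVec_mulVec,
    add_dotProduct, smul_dotProduct, smul_eq_mul, op_smul_eq_smul]
  ring

lemma avgW_inv_mulVec (ho : OrthoPair ν.a ν.b) (h : RoleInv Q α₀ β₀ N k .const ν.eig)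
    (e : Fin 2 → ℝ) :
    (ν.avgW)⁻¹ *ᵥ e = ν.invVec e ∧ ν.avgW *ᵥ (ν.invVec e) = e := by
  obtain ⟨h1, h2, h3, h4⟩ := h
  have hM : ν.avgW * (ν.eig.al • Matrix.vecMulVec ν.a ν.a +
      ν.eig.be • Matrix.vecMulVec ν.b ν.b) = 1 := by
    rw [← ho.vecMulVec_add]
    simp only [Node.avgW, add_mul, mul_add, smul_mul_assoc, mul_smul_comm,
      Matrix.vecMulVec_mul_vecMulVec, ho.aa, ho.bb, ho.ab, ho.ba]
    rw [h3, h4]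
    ext i j
    simp [Matrix.vecMulVec_apply]
    field_simp
  have hv : (ν.eig.al • Matrix.vecMulVec ν.a ν.a +
      ν.eig.be • Matrix.vecMulVec ν.b ν.b) *ᵥ e = ν.invVec e := by
    simp only [Node.invVec, Matrix.add_mulVec, Matrix.smul_mulVec, Matrix.vecMulVec_mulVec,
      op_smul_eq_smul, smul_smul]
  constructor
  · rw [Matrix.inv_eq_right_inv hM, hv]
  · rw [← hv, Matrix.mulVec_mulVec, hM, Matrix.one_mulVec]

end


/-! ### Averages of the test function -/

/-- Standing assumptions on the parameters of the construction. -/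
structure Admissible (Q α₀ β₀ : ℝ) (a₀ b₀ : Fin 2 → ℝ) : Prop where
  two_le : 2 ≤ Q
  be_pos : 0 < β₀
  be_le_al : β₀ ≤ α₀
  ortho : OrthoPair a₀ b₀

section

variable {Q α₀ β₀ : ℝ} {a₀ b₀ : Fin 2 → ℝ} {N : ℕ}

lemma node_succ_two_mul (k j : ℕ) : node Q α₀ β₀ a₀ b₀ N (k + 1) (2 * j) =
    (node Q α₀ β₀ a₀ b₀ N k j).child Q α₀ β₀ N (-1) := by
  have h : ¬ (2 * j % 2 = 1) := by omega
  have h2 : 2 * j / 2 = j := by omega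
  rw [node, if_neg h, h2]

lemma node_succ_two_mul_add_one (k j : ℕ) : node Q α₀ β₀ a₀ b₀ N (k + 1) (2 * j + 1) =
    (node Q α₀ β₀ a₀ b₀ N k j).child Q α₀ β₀ N 1 := by
  have h : (2 * j + 1) % 2 = 1 := by omega
  have h2 : (2 * j + 1) / 2 = j := by omega
  rw [node, if_pos h, h2]

lemma node_succ_of_const {k j : ℕ} (h : (node Q α₀ β₀ a₀ b₀ N k (j / 2)).role = .const) :
    node Q α₀ β₀ a₀ b₀ N (k + 1) j = node Q α₀ β₀ a₀ b₀ N k (j / 2) := by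
  rw [node, child_of_const h]

lemma node_floor_of_const {k l : ℕ} {x : ℝ} (hl : k ≤ l)
    (h : (node Q α₀ β₀ a₀ b₀ N k ⌊x * 2 ^ k⌋₊).role = .const) :
    node Q α₀ β₀ a₀ b₀ N l ⌊x * 2 ^ l⌋₊ = node Q α₀ β₀ a₀ b₀ N k ⌊x * 2 ^ k⌋₊ := by
  induction l, hl using Nat.le_induction with
  | base => rfl
  | succ l hl ih =>
    rw [node_succ_of_const, floor_pow_succ_div_two, ih]
    rw [floor_pow_succ_div_two, ih, h]

lemma node_valid (hA : Admissible Q α₀ β₀ a₀ b₀) (k j : ℕ) :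
    (node Q α₀ β₀ a₀ b₀ N k j).Valid Q α₀ β₀ N k := by
  induction k generalizing j with
  | zero => exact ⟨hA.ortho, rfl, Nat.zero_le _, rfl⟩
  | succ k ih =>
    exact (ih (j / 2)).child hA.two_le hA.be_pos hA.be_le_al (by split_ifs <;> simp)

lemma node_role_const (hA : Admissible Q α₀ β₀ a₀ b₀) {k : ℕ} (hk : 2 * N + 1 ≤ k) (j : ℕ) :
    (node Q α₀ β₀ a₀ b₀ N k j).role = .const :=
  (node_valid hA k j).role_const hk

lemma weight_eq_of_const (hA : Admissible Q α₀ β₀ a₀ b₀) {k j : ℕ} {x : ℝ}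
    (h : (node Q α₀ β₀ a₀ b₀ N k j).role = .const) (hx : x ∈ dyadic k j) :
    weight Q α₀ β₀ a₀ b₀ N x = (node Q α₀ β₀ a₀ b₀ N k j).avgW := by
  have hj := floor_of_mem_dyadic hx
  subst hj
  rw [weight]
  rcases le_total k (2 * N + 1) with hk | hk
  · rw [node_floor_of_const hk h]
  · rw [← node_floor_of_const hk (node_role_const hA le_rfl _)]

lemma roleInv_const (hA : Admissible Q α₀ β₀ a₀ b₀) {k j : ℕ}
    (h : (node Q α₀ β₀ a₀ b₀ N k j).role = .const) :
    RoleInv Q α₀ β₀ N k .const (node Q α₀ β₀ a₀ b₀ N k j).eig := by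
  have := (node_valid (N := N) hA k j).role
  rwa [h] at this

lemma testFun_eq_of_const (hA : Admissible Q α₀ β₀ a₀ b₀) {k j : ℕ} {x : ℝ} (hj : j < 2 ^ k)
    (h : (node Q α₀ β₀ a₀ b₀ N k j).role = .const) (hx : x ∈ dyadic k j) (e : Fin 2 → ℝ) :
    testFun (weight Q α₀ β₀ a₀ b₀ N) e x = (node Q α₀ β₀ a₀ b₀ N k j).invVec e := by
  rw [testFun, Set.indicator_of_mem (dyadic_subset hj hx), weight_eq_of_const hA h hx,
    (avgW_inv_mulVec (node_valid hA k j).ortho (roleInv_const hA h) e).1]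

lemma weight_mulVec_testFun (hA : Admissible Q α₀ β₀ a₀ b₀) {x : ℝ} (hx : x ∈ Set.Ico (0 : ℝ) 1)
    (e : Fin 2 → ℝ) :
    weight Q α₀ β₀ a₀ b₀ N x *ᵥ testFun (weight Q α₀ β₀ a₀ b₀ N) e x = e := by
  have hd : x ∈ dyadic (2 * N + 1) ⌊x * 2 ^ (2 * N + 1)⌋₊ := (mem_dyadic_iff hx.1).2 rfl
  have hc := node_role_const (N := N) hA le_rfl ⌊x * 2 ^ (2 * N + 1)⌋₊
  rw [testFun_eq_of_const hA (floor_lt_of_mem_Ico hx _) hc hd, weight_eq_of_const hA hc hd,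
    (avgW_inv_mulVec (node_valid hA _ _).ortho (roleInv_const hA hc) e).2]

lemma integral_testFun (hA : Admissible Q α₀ β₀ a₀ b₀) (e : Fin 2 → ℝ) (k j : ℕ)
    (hj : j < 2 ^ k) :
    IntegrableOn (testFun (weight Q α₀ β₀ a₀ b₀ N) e) (dyadic k j) ∧
      ∫ x in dyadic k j, testFun (weight Q α₀ β₀ a₀ b₀ N) e x =
        ((2 : ℝ) ^ k)⁻¹ • (node Q α₀ β₀ a₀ b₀ N k j).invVec e := by
  obtain ⟨d, hd⟩ : ∃ d, 2 * N + 1 ≤ k + d := ⟨2 * N + 1, by omega⟩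
  induction d generalizing k j with
  | zero =>
    have hc := node_role_const (N := N) hA hd j
    have heq : Set.EqOn (testFun (weight Q α₀ β₀ a₀ b₀ N) e)
        (fun _ => (node Q α₀ β₀ a₀ b₀ N k j).invVec e) (dyadic k j) :=
      fun x hx => testFun_eq_of_const hA hj hc hx e
    have hfin : volume (dyadic k j) ≠ ⊤ := by rw [volume_dyadic]; exact ENNReal.ofReal_ne_top
    refine ⟨(integrableOn_congr_fun heq (measurableSet_dyadic k j)).2 (integrableOn_const hfin), ?_⟩
    rw [setIntegral_congr_fun (measurableSet_dyadic k j) heq, setIntegral_const, Measure.real,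
      volume_dyadic, ENNReal.toReal_ofReal (by positivity)]
  | succ d ih =>
    obtain ⟨i1, v1⟩ := ih (k + 1) (2 * j) (by rw [pow_succ]; omega) (by omega)
    obtain ⟨i2, v2⟩ := ih (k + 1) (2 * j + 1) (by rw [pow_succ]; omega) (by omega)
    rw [← dyadic_union k j]
    refine ⟨i1.union i2, ?_⟩
    rw [setIntegral_union (dyadic_disjoint _ (by omega)) (measurableSet_dyadic _ _) i1 i2, v1, v2,
      ← smul_add, node_succ_two_mul, node_succ_two_mul_add_one,
      add_comm (Node.invVec _ _), invVec_child_add hA.two_le hA.be_pos hA.be_le_al (node_valid hA k j), smul_smul]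
    congr 1
    rw [pow_succ]
    field_simp

/-- Half-difference of the averages of the test function over the halves of a dyadic interval. -/
def diff (Q α₀ β₀ : ℝ) (a₀ b₀ : Fin 2 → ℝ) (N : ℕ) (e : Fin 2 → ℝ) (k j : ℕ) : Fin 2 → ℝ :=
  (node Q α₀ β₀ a₀ b₀ N k j).halfDiff Q α₀ β₀ N e

lemma haarCoeff_testFun (hA : Admissible Q α₀ β₀ a₀ b₀) (e : Fin 2 → ℝ) {k j : ℕ}
    (hj : j < 2 ^ k) :
    haarCoeff (testFun (weight Q α₀ β₀ a₀ b₀ N) e) k j =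
      (√(2 ^ k))⁻¹ • diff Q α₀ β₀ a₀ b₀ N e k j := by
  obtain ⟨i1, v1⟩ := integral_testFun (N := N) hA e (k + 1) (2 * j) (by rw [pow_succ]; omega)
  obtain ⟨i2, v2⟩ := integral_testFun (N := N) hA e (k + 1) (2 * j + 1) (by rw [pow_succ]; omega)
  set f := testFun (weight Q α₀ β₀ a₀ b₀ N) e
  have h1 : ∀ x, haar k j x • f x = √(2 ^ k) • ((dyadic (k + 1) (2 * j + 1)).indicator f x -
      (dyadic (k + 1) (2 * j)).indicator f x) := by
    intro x
    classical
    simp only [haar, Set.indicator_apply, Pi.one_apply, mul_smul, sub_smul, ite_smul, one_smul,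
      zero_smul]
  rw [haarCoeff]
  simp only [h1]
  rw [integral_smul, integral_sub (i2.integrable_indicator (measurableSet_dyadic _ _))
      (i1.integrable_indicator (measurableSet_dyadic _ _)),
    integral_indicator (measurableSet_dyadic _ _), integral_indicator (measurableSet_dyadic _ _),
    v1, v2, node_succ_two_mul, node_succ_two_mul_add_one, ← smul_sub, diff, Node.halfDiff,
    smul_smul, smul_smul]
  congr 1
  have h0 : (0 : ℝ) < 2 ^ k := by positivity
  have h2 := Real.mul_self_sqrt h0.le
  have h3 : 0 < √((2 : ℝ) ^ k) := Real.sqrt_pos.2 h0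
  rw [pow_succ]
  nth_rw 2 [← h2]
  field_simp

lemma diff_of_const {e : Fin 2 → ℝ} {k j : ℕ}
    (h : (node Q α₀ β₀ a₀ b₀ N k j).role = .const) : diff Q α₀ β₀ a₀ b₀ N e k j = 0 :=
  halfDiff_const h e

/-- `‖f‖²_{L²(W)} = (⟨W⁻¹⟩ e, e)` for the test function `f`. -/
lemma weightedNorm_testFun (hA : Admissible Q α₀ β₀ a₀ b₀) (e : Fin 2 → ℝ) :
    weightedNorm (weight Q α₀ β₀ a₀ b₀ N) (testFun (weight Q α₀ β₀ a₀ b₀ N) e) =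
      ENNReal.ofReal (α₀ * (a₀ ⬝ᵥ e) ^ 2 + β₀ * (b₀ ⬝ᵥ e) ^ 2) ^ (1 / 2 : ℝ) := by
  obtain ⟨i, v⟩ := integral_testFun (N := N) hA e 0 0 (by norm_num)
  rw [dyadic_zero_zero] at i v
  rw [weightedNorm]
  congr 1
  set f := testFun (weight Q α₀ β₀ a₀ b₀ N) e
  have h1 : ∀ x ∈ Set.Ico (0 : ℝ) 1, ENNReal.ofReal ((weight Q α₀ β₀ a₀ b₀ N x *ᵥ f x) ⬝ᵥ f x) =
      ENNReal.ofReal (e ⬝ᵥ f x) := fun x hx => by rw [weight_mulVec_testFun hA hx]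
  have h2 : ∀ x ∈ Set.Ico (0 : ℝ) 1, 0 ≤ e ⬝ᵥ f x := by
    intro x hx
    rw [← weight_mulVec_testFun (N := N) hA hx e]
    have hd : x ∈ dyadic (2 * N + 1) ⌊x * 2 ^ (2 * N + 1)⌋₊ := (mem_dyadic_iff hx.1).2 rfl
    have hc := node_role_const (N := N) hA le_rfl ⌊x * 2 ^ (2 * N + 1)⌋₊
    obtain ⟨p1, p2, -, -⟩ := roleInv_const hA hc
    rw [weight_eq_of_const hA hc hd, avgW_mulVec_dotProduct]
    positivity
  have h3 : IntegrableOn (fun x => e ⬝ᵥ f x) (Set.Ico (0 : ℝ) 1) := by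
    simp only [dotProduct, Fin.sum_univ_two]
    exact ((Integrable.eval i 0).const_mul _).add ((Integrable.eval i 1).const_mul _)
  rw [setLIntegral_congr_fun measurableSet_Ico h1,
    ← ofReal_integral_eq_lintegral_ofReal h3 ((ae_restrict_iff' measurableSet_Ico).2
      (Filter.Eventually.of_forall h2))]
  congr 1
  have h4 : ∫ x in Set.Ico (0 : ℝ) 1, e ⬝ᵥ f x = e ⬝ᵥ ∫ x in Set.Ico (0 : ℝ) 1, f x := by
    simp only [dotProduct, Fin.sum_univ_two]
    rw [integral_add ((Integrable.eval i 0).const_mul _) ((Integrable.eval i 1).const_mul _),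
      integral_const_mul, integral_const_mul, eval_integral fun j => Integrable.eval i j,
      eval_integral fun j => Integrable.eval i j]
  rw [h4, v]
  simp only [pow_zero, inv_one, one_smul, Node.invVec, node, stopEigen, dotProduct_comm e,
    add_dotProduct, smul_dotProduct, smul_eq_mul]
  ring

end


/-! ### Values of the operators on the test function -/

/-- The operator `c₁ 𝕊 - c₃ 𝕊* + c₂ 𝕊₀`. -/
def genOp (c₁ c₂ c₃ : ℝ) (f : ℝ → Fin 2 → ℝ) (x : ℝ) : Fin 2 → ℝ :=
  c₁ • oddShift f x - c₃ • oddShiftAdj f x + c₂ • oddShiftZero f x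

/-- The other child of the parent. -/
def sibling (j : ℕ) : ℕ := if j % 2 = 1 then j - 1 else j + 1

lemma sibling_two_mul (j : ℕ) : sibling (2 * j) = 2 * j + 1 := by
  have h : ¬ (2 * j % 2 = 1) := by omega
  rw [sibling, if_neg h]

lemma sibling_two_mul_add_one (j : ℕ) : sibling (2 * j + 1) = 2 * j := by
  have h : (2 * j + 1) % 2 = 1 := by omega
  rw [sibling, if_pos h]
  omega

lemma sibling_div_two (j : ℕ) : sibling j / 2 = j / 2 := by
  rw [sibling]; split_ifs <;> omega

/-- Normalized Haar coefficient of `(c₁ 𝕊 - c₃ 𝕊* + c₂ 𝕊₀) f` at the interval `(k, j)`, in terms of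
the normalized Haar coefficients `d` of `f`. -/
def incr (c₁ c₂ c₃ : ℝ) (d : ℕ → ℕ → Fin 2 → ℝ) (k j : ℕ) : Fin 2 → ℝ :=
  if k = 0 then 0 else
  if k % 2 = 1 then -((c₃ / √2) • (d (k + 1) (2 * j + 1) - d (k + 1) (2 * j)))
  else sgn j • ((c₁ * √2) • d (k - 1) (j / 2) - c₂ • d k (sibling j))

lemma incr_odd (c₁ c₂ c₃ : ℝ) (d : ℕ → ℕ → Fin 2 → ℝ) (m j : ℕ) :
    incr c₁ c₂ c₃ d (2 * m + 1) j =
      -((c₃ / √2) • (d (2 * m + 2) (2 * j + 1) - d (2 * m + 2) (2 * j))) := by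
  have h : (2 * m + 1) % 2 = 1 := by omega
  rw [incr, if_neg (by omega), if_pos h]

lemma incr_even (c₁ c₂ c₃ : ℝ) (d : ℕ → ℕ → Fin 2 → ℝ) (m j : ℕ) :
    incr c₁ c₂ c₃ d (2 * m + 2) j =
      sgn j • ((c₁ * √2) • d (2 * m + 1) (j / 2) - c₂ • d (2 * m + 2) (sibling j)) := by
  have h : ¬ ((2 * m + 2) % 2 = 1) := by omega
  rw [incr, if_neg (by omega), if_neg h]
  rfl

/-- The sum of the terms of the Haar expansion of generation less than `k`, on the interval
`(k, j)`. -/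
def partialVal (c : ℕ → ℕ → Fin 2 → ℝ) : ℕ → ℕ → Fin 2 → ℝ
  | 0, _ => 0
  | k + 1, j => partialVal c k (j / 2) + sgn j • c k (j / 2)

lemma sqrt_two_pow_succ (k : ℕ) : √((2 : ℝ) ^ (k + 1)) = √2 * √(2 ^ k) := by
  rw [pow_succ', Real.sqrt_mul (by norm_num)]

lemma sqrt_two_pow_mul_inv (k : ℕ) (s : ℝ) :
    √((2 : ℝ) ^ k) * s * (√(2 ^ k))⁻¹ = s := by
  have h3 : 0 < √((2 : ℝ) ^ k) := Real.sqrt_pos.2 (by positivity)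
  field_simp

lemma sqrt_two_pow_succ_mul_inv (k : ℕ) (s : ℝ) :
    √((2 : ℝ) ^ (k + 1)) * s * (√(2 ^ k))⁻¹ = √2 * s := by
  have h3 : 0 < √((2 : ℝ) ^ k) := Real.sqrt_pos.2 (by positivity)
  rw [sqrt_two_pow_succ]; field_simp

lemma sqrt_two_pow_mul_inv_succ (k : ℕ) (s : ℝ) :
    √((2 : ℝ) ^ k) * s * (√(2 ^ (k + 1)))⁻¹ = s / √2 := by
  have h3 : 0 < √((2 : ℝ) ^ k) := Real.sqrt_pos.2 (by positivity)
  rw [sqrt_two_pow_succ]; field_simp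

section

variable {f : ℝ → Fin 2 → ℝ} {d : ℕ → ℕ → Fin 2 → ℝ} {x : ℝ}

lemma oddShift_term (hf : ∀ k j, j < 2 ^ k → haarCoeff f k j = (√(2 ^ k))⁻¹ • d k j)
    (hx : x ∈ Set.Ico (0 : ℝ) 1) (m : ℕ) :
    ∑ j ∈ Finset.range (2 ^ (2 * m + 1)),
      (haar (2 * m + 2) (2 * j + 1) x - haar (2 * m + 2) (2 * j) x) • haarCoeff f (2 * m + 1) j =
    (√2 * (sgn ⌊x * 2 ^ (2 * m + 2)⌋₊ * sgn ⌊x * 2 ^ (2 * m + 3)⌋₊)) •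
      d (2 * m + 1) (⌊x * 2 ^ (2 * m + 2)⌋₊ / 2) := by
  have h : ⌊x * 2 ^ (2 * m + 2)⌋₊ / 2 = ⌊x * 2 ^ (2 * m + 1)⌋₊ :=
    floor_pow_succ_div_two (2 * m + 1) x
  have hlt := floor_lt_of_mem_Ico hx (2 * m + 1)
  rw [Finset.sum_eq_single ⌊x * 2 ^ (2 * m + 1)⌋₊]
  · rw [hf _ _ hlt, smul_smul, h, haar_apply _ _ hx.1, haar_apply _ _ hx.1]
    congr 1
    rcases Nat.even_or_odd' ⌊x * 2 ^ (2 * m + 2)⌋₊ with ⟨c, hc | hc⟩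
    · have : ⌊x * 2 ^ (2 * m + 1)⌋₊ = c := by omega
      rw [this, hc, if_neg (by omega), if_pos rfl, sgn_two_mul, zero_sub, ← mul_neg,
        sqrt_two_pow_succ_mul_inv]
      ring
    · have : ⌊x * 2 ^ (2 * m + 1)⌋₊ = c := by omega
      rw [this, hc, if_pos rfl, if_neg (by omega), sgn_two_mul_add_one, sub_zero,
        sqrt_two_pow_succ_mul_inv]
      ring
  · intro j _ hj
    rw [haar_apply _ _ hx.1, haar_apply _ _ hx.1, if_neg (by omega), if_neg (by omega)]
    simp
  · intro h'
    exact absurd (Finset.mem_range.2 hlt) h'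

lemma oddShiftAdj_term (hf : ∀ k j, j < 2 ^ k → haarCoeff f k j = (√(2 ^ k))⁻¹ • d k j)
    (hx : x ∈ Set.Ico (0 : ℝ) 1) (m : ℕ) :
    ∑ j ∈ Finset.range (2 ^ (2 * m + 1)), haar (2 * m + 1) j x •
      (haarCoeff f (2 * m + 2) (2 * j + 1) - haarCoeff f (2 * m + 2) (2 * j)) =
    (sgn ⌊x * 2 ^ (2 * m + 2)⌋₊ / √2) •
      (d (2 * m + 2) (2 * ⌊x * 2 ^ (2 * m + 1)⌋₊ + 1) -
        d (2 * m + 2) (2 * ⌊x * 2 ^ (2 * m + 1)⌋₊)) := by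
  have hlt := floor_lt_of_mem_Ico hx (2 * m + 1)
  have hp : 2 ^ (2 * m + 2) = 2 * 2 ^ (2 * m + 1) := by rw [pow_succ]; ring
  rw [Finset.sum_eq_single ⌊x * 2 ^ (2 * m + 1)⌋₊]
  · rw [hf _ _ (by omega), hf _ _ (by omega), ← smul_sub, smul_smul, haar_apply _ _ hx.1,
      if_pos rfl, sqrt_two_pow_mul_inv_succ]
  · intro j _ hj
    rw [haar_apply _ _ hx.1, if_neg (by omega), zero_smul]
  · intro h'
    exact absurd (Finset.mem_range.2 hlt) h'

lemma oddShiftZero_term (hf : ∀ k j, j < 2 ^ k → haarCoeff f k j = (√(2 ^ k))⁻¹ • d k j)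
    (hx : x ∈ Set.Ico (0 : ℝ) 1) (m : ℕ) :
    ∑ j ∈ Finset.range (2 ^ (2 * m + 1)),
      (haar (2 * m + 2) (2 * j) x • haarCoeff f (2 * m + 2) (2 * j + 1) -
        haar (2 * m + 2) (2 * j + 1) x • haarCoeff f (2 * m + 2) (2 * j)) =
    -((sgn ⌊x * 2 ^ (2 * m + 2)⌋₊ * sgn ⌊x * 2 ^ (2 * m + 3)⌋₊) •
      d (2 * m + 2) (sibling ⌊x * 2 ^ (2 * m + 2)⌋₊)) := by
  have h : ⌊x * 2 ^ (2 * m + 2)⌋₊ / 2 = ⌊x * 2 ^ (2 * m + 1)⌋₊ :=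
    floor_pow_succ_div_two (2 * m + 1) x
  have hlt := floor_lt_of_mem_Ico hx (2 * m + 1)
  have hp : 2 ^ (2 * m + 2) = 2 * 2 ^ (2 * m + 1) := by rw [pow_succ]; ring
  rw [Finset.sum_eq_single ⌊x * 2 ^ (2 * m + 1)⌋₊]
  · rw [hf _ _ (by omega), hf _ _ (by omega), smul_smul, smul_smul, haar_apply _ _ hx.1,
      haar_apply _ _ hx.1]
    rcases Nat.even_or_odd' ⌊x * 2 ^ (2 * m + 2)⌋₊ with ⟨c, hc | hc⟩
    · have : ⌊x * 2 ^ (2 * m + 1)⌋₊ = c := by omega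
      have hne : ¬ (2 * c = 2 * c + 1) := by omega
      rw [this, hc, if_pos rfl, if_neg hne, sqrt_two_pow_mul_inv, sgn_two_mul, sibling_two_mul]
      simp
    · have : ⌊x * 2 ^ (2 * m + 1)⌋₊ = c := by omega
      have hne : ¬ (2 * c + 1 = 2 * c) := by omega
      rw [this, hc, if_pos rfl, if_neg hne, sqrt_two_pow_mul_inv, sgn_two_mul_add_one,
        sibling_two_mul_add_one]
      simp
  · intro j _ hj
    rw [haar_apply _ _ hx.1, haar_apply _ _ hx.1, if_neg (by omega), if_neg (by omega)]
    simp
  · intro h'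
    exact absurd (Finset.mem_range.2 hlt) h'

/-- For a function with a finite Haar expansion the operator is given by the partial values. -/
lemma genOp_eq_partialVal (c₁ c₂ c₃ : ℝ) {N : ℕ}
    (hf : ∀ k j, j < 2 ^ k → haarCoeff f k j = (√(2 ^ k))⁻¹ • d k j)
    (hd : ∀ k j, 2 * N + 1 ≤ k → d k j = 0) (hx : x ∈ Set.Ico (0 : ℝ) 1) :
    genOp c₁ c₂ c₃ f x =
      partialVal (incr c₁ c₂ c₃ d) (2 * N + 1) ⌊x * 2 ^ (2 * N + 1)⌋₊ := by
  have hsum : ∀ M, partialVal (incr c₁ c₂ c₃ d) (2 * M + 1) ⌊x * 2 ^ (2 * M + 1)⌋₊ =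
      ∑ m ∈ Finset.range M,
        (sgn ⌊x * 2 ^ (2 * m + 2)⌋₊ • incr c₁ c₂ c₃ d (2 * m + 1) ⌊x * 2 ^ (2 * m + 1)⌋₊ +
          sgn ⌊x * 2 ^ (2 * m + 3)⌋₊ • incr c₁ c₂ c₃ d (2 * m + 2) ⌊x * 2 ^ (2 * m + 2)⌋₊) := by
    intro M
    induction M with
    | zero => simp [partialVal, incr]
    | succ M ih =>
      rw [Finset.sum_range_succ, ← ih]
      change partialVal _ (2 * M + 1 + 1 + 1) ⌊x * 2 ^ (2 * M + 1 + 1 + 1)⌋₊ = _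
      rw [partialVal, floor_pow_succ_div_two, partialVal, floor_pow_succ_div_two, add_assoc]
  rw [hsum, genOp, oddShift, oddShiftAdj, oddShiftZero]
  simp only [oddShift_term hf hx, oddShiftAdj_term hf hx, oddShiftZero_term hf hx]
  rw [tsum_eq_sum (s := Finset.range N), tsum_eq_sum (s := Finset.range N),
    tsum_eq_sum (s := Finset.range N), Finset.smul_sum, Finset.smul_sum, Finset.smul_sum,
    ← Finset.sum_sub_distrib, ← Finset.sum_add_distrib]
  · refine Finset.sum_congr rfl fun m _ => ?_
    rw [incr_odd, incr_even, div_eq_mul_inv c₃, div_eq_mul_inv (sgn _)]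
    module
  all_goals
    intro m hm
    rw [Finset.mem_range, not_lt] at hm
    simp [hd _ _ (show 2 * N + 1 ≤ 2 * m + 1 by omega), hd _ _ (show 2 * N + 1 ≤ 2 * m + 2 by omega)]

end

section

variable {Q α₀ β₀ : ℝ} {a₀ b₀ : Fin 2 → ℝ} {N : ℕ}

/-- The partial values for the test function. -/
def testVal (Q α₀ β₀ : ℝ) (a₀ b₀ : Fin 2 → ℝ) (N : ℕ) (e : Fin 2 → ℝ) (c₁ c₂ c₃ : ℝ) :
    ℕ → ℕ → Fin 2 → ℝ :=
  partialVal (incr c₁ c₂ c₃ (diff Q α₀ β₀ a₀ b₀ N e))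

lemma incr_of_const {e : Fin 2 → ℝ} {c₁ c₂ c₃ : ℝ} {k j : ℕ}
    (h : (node Q α₀ β₀ a₀ b₀ N k j).role = .const)
    (h' : 2 ∣ k → (node Q α₀ β₀ a₀ b₀ N (k - 1) (j / 2)).role = .const) :
    incr c₁ c₂ c₃ (diff Q α₀ β₀ a₀ b₀ N e) k j = 0 := by
  obtain ⟨m, hm | hm⟩ := Nat.even_or_odd' k
  · rcases m with _ | m
    · simp [incr, hm]
    · have hk : k = 2 * m + 2 := by omega
      subst hk
      have h2 := h' ⟨m + 1, rfl⟩
      have h3 : (node Q α₀ β₀ a₀ b₀ N (2 * m + 2) (sibling j)).role = .const := by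
        rw [node_succ_of_const] <;> rw [sibling_div_two] <;> exact h2
      rw [incr_even, diff_of_const h3]
      rw [diff_of_const (k := 2 * m + 1) h2]
      simp
  · subst hm
    have h1 : (node Q α₀ β₀ a₀ b₀ N (2 * m + 2) (2 * j + 1)).role = .const := by
      rw [node_succ_two_mul_add_one, child_of_const h, h]
    have h2 : (node Q α₀ β₀ a₀ b₀ N (2 * m + 2) (2 * j)).role = .const := by
      rw [node_succ_two_mul, child_of_const h, h]
    rw [incr_odd, diff_of_const h1, diff_of_const h2]
    simp

/-- On an interval of odd generation where the weight is constant, the value of the operator is the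
partial value. -/
lemma genOp_testFun (hA : Admissible Q α₀ β₀ a₀ b₀) (e : Fin 2 → ℝ) (c₁ c₂ c₃ : ℝ) {k j : ℕ} {x : ℝ}
    (hk : k ≤ 2 * N + 1) (hk2 : k % 2 = 1) (hj : j < 2 ^ k)
    (h : (node Q α₀ β₀ a₀ b₀ N k j).role = .const) (hx : x ∈ dyadic k j) :
    genOp c₁ c₂ c₃ (testFun (weight Q α₀ β₀ a₀ b₀ N) e) x =
      testVal Q α₀ β₀ a₀ b₀ N e c₁ c₂ c₃ k j := by
  have hx' := dyadic_subset hj hx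
  rw [genOp_eq_partialVal c₁ c₂ c₃ (N := N) (fun k j hj => haarCoeff_testFun hA e hj)
    (fun k j hk => diff_of_const (node_role_const hA hk j)) hx']
  have hfl := floor_of_mem_dyadic hx
  subst hfl
  generalize 2 * N + 1 = l at hk
  change testVal Q α₀ β₀ a₀ b₀ N e c₁ c₂ c₃ l _ = _
  induction l, hk using Nat.le_induction with
  | base => rfl
  | succ l hl ih =>
    rw [testVal, partialVal, floor_pow_succ_div_two, incr_of_const, smul_zero, add_zero]
    · exact ih
    · rw [node_floor_of_const hl h, h]
    · intro hl2
      obtain ⟨p, rfl⟩ : ∃ p, l = p + 1 := ⟨l - 1, by omega⟩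
      rw [Nat.add_sub_cancel, floor_pow_succ_div_two, node_floor_of_const (by omega) h, h]

end


/-! ### Stopping intervals -/

/-- Positions of the stopping intervals of generation `n` among the dyadic intervals of generation
`2n`. -/
def stops : ℕ → Finset ℕ
  | 0 => {0}
  | n + 1 => (stops n).image (fun j => 4 * j + 1) ∪ (stops n).image (fun j => 4 * j + 3)

lemma mem_stops_succ {n j : ℕ} :
    j ∈ stops (n + 1) ↔ ∃ i ∈ stops n, j = 4 * i + 1 ∨ j = 4 * i + 3 := by
  simp only [stops, Finset.mem_union, Finset.mem_image]
  constructor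
  · rintro (⟨i, hi, rfl⟩ | ⟨i, hi, rfl⟩)
    · exact ⟨i, hi, Or.inl rfl⟩
    · exact ⟨i, hi, Or.inr rfl⟩
  · rintro ⟨i, hi, rfl | rfl⟩
    · exact Or.inl ⟨i, hi, rfl⟩
    · exact Or.inr ⟨i, hi, rfl⟩

lemma lt_of_mem_stops {n j : ℕ} (hj : j ∈ stops n) : j < 2 ^ (2 * n) := by
  induction n generalizing j with
  | zero => simp [stops] at hj; simp [hj]
  | succ n ih =>
    obtain ⟨i, hi, h⟩ := mem_stops_succ.1 hj
    have := ih hi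
    rw [show 2 * (n + 1) = 2 * n + 2 by ring, pow_add]
    omega

lemma sum_stops_succ {M : Type*} [AddCommMonoid M] (n : ℕ) (Φ : ℕ → M) :
    ∑ j ∈ stops (n + 1), Φ j = ∑ j ∈ stops n, (Φ (4 * j + 1) + Φ (4 * j + 3)) := by
  rw [stops, Finset.sum_union, Finset.sum_image, Finset.sum_image, Finset.sum_add_distrib]
  · intro i _ j _ h; dsimp only at h; omega
  · intro i _ j _ h; dsimp only at h; omega
  · rw [Finset.disjoint_left]
    intro j h1 h2
    obtain ⟨a, -, ha⟩ := Finset.mem_image.1 h1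
    obtain ⟨b, -, hb⟩ := Finset.mem_image.1 h2
    omega

lemma card_stops (n : ℕ) : (stops n).card = 2 ^ n := by
  induction n with
  | zero => rfl
  | succ n ih =>
    rw [Finset.card_eq_sum_ones, sum_stops_succ, Finset.sum_const, ih, pow_succ]
    rfl

/-- The basis vectors on the right (`ε = 1`) and left (`ε = -1`) half of a stopping interval. -/
def rotA (δ ε : ℝ) (a b : Fin 2 → ℝ) : Fin 2 → ℝ := (√(1 + δ ^ 2))⁻¹ • (a + (ε * δ) • b)

/-- See `rotA`. -/
def rotB (δ ε : ℝ) (a b : Fin 2 → ℝ) : Fin 2 → ℝ := (√(1 + δ ^ 2))⁻¹ • (b - (ε * δ) • a)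

lemma OrthoPair.rot {a b : Fin 2 → ℝ} (h : OrthoPair a b) (δ : ℝ) {ε : ℝ} (hε : ε = 1 ∨ ε = -1) :
    OrthoPair (rotA δ ε a b) (rotB δ ε a b) := by
  have := h.rotate (ε * δ)
  have e : (ε * δ) ^ 2 = δ ^ 2 := by rcases hε with rfl | rfl <;> ring
  rwa [e] at this

section

variable {Q α₀ β₀ : ℝ} {a₀ b₀ : Fin 2 → ℝ} {N : ℕ} {n j i : ℕ} {a b e : Fin 2 → ℝ} {c₁ c₂ c₃ : ℝ}

lemma node_rotated_of_stopping (hn : n < N)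
    (h : node Q α₀ β₀ a₀ b₀ N (2 * n) j = ⟨.stopping n, stopEigen Q α₀ β₀ n, a, b⟩) :
    node Q α₀ β₀ a₀ b₀ N (2 * n + 1) (2 * j) =
        ⟨.rotated n, (stopEigen Q α₀ β₀ n).rotate, rotA (stopEigen Q α₀ β₀ n).delta (-1) a b,
          rotB (stopEigen Q α₀ β₀ n).delta (-1) a b⟩ ∧
      node Q α₀ β₀ a₀ b₀ N (2 * n + 1) (2 * j + 1) =
        ⟨.rotated n, (stopEigen Q α₀ β₀ n).rotate, rotA (stopEigen Q α₀ β₀ n).delta 1 a b,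
          rotB (stopEigen Q α₀ β₀ n).delta 1 a b⟩ := by
  rw [node_succ_two_mul, node_succ_two_mul_add_one, h]
  simp only [Node.child, if_pos hn]
  exact ⟨rfl, rfl⟩

lemma node_children_of_rotated
    (h : node Q α₀ β₀ a₀ b₀ N (2 * n + 1) i = ⟨.rotated n, (stopEigen Q α₀ β₀ n).rotate, a, b⟩) :
    node Q α₀ β₀ a₀ b₀ N (2 * n + 2) (2 * i) =
        ⟨.terminal, (stopEigen Q α₀ β₀ n).rotate.stretchLeft Q, a, b⟩ ∧
      node Q α₀ β₀ a₀ b₀ N (2 * n + 2) (2 * i + 1) =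
        ⟨.stopping (n + 1), stopEigen Q α₀ β₀ (n + 1), a, b⟩ ∧
      node Q α₀ β₀ a₀ b₀ N (2 * n + 3) (4 * i + 1) =
        ⟨.const, ((stopEigen Q α₀ β₀ n).rotate.stretchLeft Q).fill 1, a, b⟩ := by
  have h0 : ¬ ((0 : ℝ) < -1) := by norm_num
  have h1 : node Q α₀ β₀ a₀ b₀ N (2 * n + 2) (2 * i) =
        ⟨.terminal, (stopEigen Q α₀ β₀ n).rotate.stretchLeft Q, a, b⟩ := by
    rw [node_succ_two_mul, h]
    simp only [Node.child, if_neg h0]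
  refine ⟨h1, ?_, ?_⟩
  · rw [node_succ_two_mul_add_one, h]
    simp only [Node.child, if_pos zero_lt_one]
  · rw [show 4 * i + 1 = 2 * (2 * i) + 1 by ring, node_succ_two_mul_add_one, h1]
    rfl

lemma node_of_mem_stops (hn : n ≤ N) (hj : j ∈ stops n) :
    ∃ a b, node Q α₀ β₀ a₀ b₀ N (2 * n) j = ⟨.stopping n, stopEigen Q α₀ β₀ n, a, b⟩ := by
  induction n generalizing j with
  | zero => exact ⟨a₀, b₀, rfl⟩
  | succ n ih =>
    obtain ⟨i, hi, h⟩ := mem_stops_succ.1 hj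
    obtain ⟨a, b, hab⟩ := ih (by omega) hi
    obtain ⟨h1, h2⟩ := node_rotated_of_stopping (by omega) hab
    rcases h with rfl | rfl
    · rw [show 4 * i + 1 = 2 * (2 * i) + 1 by ring]
      exact ⟨_, _, (node_children_of_rotated h1).2.1⟩
    · rw [show 4 * i + 3 = 2 * (2 * i + 1) + 1 by ring]
      exact ⟨_, _, (node_children_of_rotated h2).2.1⟩

/-- The coefficient in `halfDiff_stopping`. -/
def rotAmp (σ : Eigen) : ℝ := σ.delta / (1 + σ.delta ^ 2) * (σ.rotate.al - σ.rotate.be)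

/-- Coefficient of `(a, e) a` in the increment on a stopping interval. -/
def stopAmpA (Q α₀ β₀ c₁ c₂ : ℝ) : ℕ → ℝ
  | 0 => 0
  | n + 1 => c₁ * √2 * ((stretchR Q - 1) * (stopEigen Q α₀ β₀ n).rotate.al) +
      c₂ * (fillParam Q (stopEigen Q α₀ β₀ n) * ((stopEigen Q α₀ β₀ n).rotate.al / Q))

/-- Coefficient of `(b, e) b` in the half-difference on a terminal interval, up to sign. -/
def fillAmp (Q : ℝ) (σ : Eigen) : ℝ := fillParam Q σ * (σ.rotate.stretchLeft Q).be

/-- Coefficient of `(b, e) b` in the half-difference on a rotated interval. -/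
def stretchAmp (Q : ℝ) (σ : Eigen) : ℝ := (1 / (σ.rotate.s Q * stretchR Q) - 1) * σ.rotate.be

lemma diff_rotated
    (h : node Q α₀ β₀ a₀ b₀ N (2 * n + 1) i = ⟨.rotated n, (stopEigen Q α₀ β₀ n).rotate, a, b⟩) :
    diff Q α₀ β₀ a₀ b₀ N e (2 * n + 1) i =
      ((stretchR Q - 1) * (stopEigen Q α₀ β₀ n).rotate.al * (a ⬝ᵥ e)) • a +
        (stretchAmp Q (stopEigen Q α₀ β₀ n) * (b ⬝ᵥ e)) • b := by
  rw [diff, h, halfDiff_rotated]; rfl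

lemma diff_terminal (hA : Admissible Q α₀ β₀ a₀ b₀)
    (h : node Q α₀ β₀ a₀ b₀ N (2 * n + 1) i = ⟨.rotated n, (stopEigen Q α₀ β₀ n).rotate, a, b⟩) :
    diff Q α₀ β₀ a₀ b₀ N e (2 * n + 2) (2 * i) =
      -((fillParam Q (stopEigen Q α₀ β₀ n) * ((stopEigen Q α₀ β₀ n).rotate.al / Q) *
          (a ⬝ᵥ e)) • a +
        (fillAmp Q (stopEigen Q α₀ β₀ n) * (b ⬝ᵥ e)) • b) := by
  rw [diff, (node_children_of_rotated h).1,
    halfDiff_terminal hA.two_le (stopEigen_balanced hA.two_le hA.be_pos hA.be_le_al n)]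
  rfl

lemma diff_stopping (hn : n + 1 < N)
    (h : node Q α₀ β₀ a₀ b₀ N (2 * n + 1) i = ⟨.rotated n, (stopEigen Q α₀ β₀ n).rotate, a, b⟩) :
    diff Q α₀ β₀ a₀ b₀ N e (2 * n + 2) (2 * i + 1) =
      rotAmp (stopEigen Q α₀ β₀ (n + 1)) • ((b ⬝ᵥ e) • a + (a ⬝ᵥ e) • b) := by
  rw [diff, (node_children_of_rotated h).2.1, halfDiff_stopping hn]
  rfl

lemma incr_stopping (hA : Admissible Q α₀ β₀ a₀ b₀)
    (h : node Q α₀ β₀ a₀ b₀ N (2 * n + 1) i = ⟨.rotated n, (stopEigen Q α₀ β₀ n).rotate, a, b⟩) :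
    incr c₁ c₂ c₃ (diff Q α₀ β₀ a₀ b₀ N e) (2 * n + 2) (2 * i + 1) =
      (stopAmpA Q α₀ β₀ c₁ c₂ (n + 1) * (a ⬝ᵥ e)) • a +
        ((c₁ * √2 * stretchAmp Q (stopEigen Q α₀ β₀ n) +
          c₂ * fillAmp Q (stopEigen Q α₀ β₀ n)) * (b ⬝ᵥ e)) • b := by
  rw [incr_even, sgn_two_mul_add_one, sibling_two_mul_add_one,
    show (2 * i + 1) / 2 = i by omega, diff_rotated h, diff_terminal hA h, stopAmpA]
  module

lemma exists_incr_of_mem_stops (hA : Admissible Q α₀ β₀ a₀ b₀) (hn : n ≤ N) (hj : j ∈ stops n)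
    (h : node Q α₀ β₀ a₀ b₀ N (2 * n) j = ⟨.stopping n, stopEigen Q α₀ β₀ n, a, b⟩) :
    ∃ κ : ℝ, incr c₁ c₂ c₃ (diff Q α₀ β₀ a₀ b₀ N e) (2 * n) j =
      (stopAmpA Q α₀ β₀ c₁ c₂ n * (a ⬝ᵥ e)) • a + κ • b := by
  rcases n with _ | n
  · exact ⟨0, by simp [incr, stopAmpA]⟩
  · obtain ⟨i, hi, hij⟩ := mem_stops_succ.1 hj
    obtain ⟨a', b', hab⟩ := node_of_mem_stops (Q := Q) (α₀ := α₀) (β₀ := β₀) (a₀ := a₀) (b₀ := b₀)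
      (N := N) (n := n) (by omega) hi
    obtain ⟨h1, h2⟩ := node_rotated_of_stopping (by omega) hab
    rcases hij with rfl | rfl
    · rw [show 4 * i + 1 = 2 * (2 * i) + 1 by ring] at h ⊢
      have := (node_children_of_rotated h1).2.1.symm.trans h
      injection this with _ _ ha hb
      rw [ha, hb] at h1
      exact ⟨_, incr_stopping hA h1⟩
    · rw [show 4 * i + 3 = 2 * (2 * i + 1) + 1 by ring] at h ⊢
      have := (node_children_of_rotated h2).2.1.symm.trans h
      injection this with _ _ ha hb
      rw [ha, hb] at h2
      exact ⟨_, incr_stopping hA h2⟩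

lemma rotB_dotProduct_testVal_stopping (hA : Admissible Q α₀ β₀ a₀ b₀) (hn : n + 1 < N)
    (ho : OrthoPair a b)
    (h : node Q α₀ β₀ a₀ b₀ N (2 * n + 1) i = ⟨.rotated n, (stopEigen Q α₀ β₀ n).rotate, a, b⟩) :
    b ⬝ᵥ testVal Q α₀ β₀ a₀ b₀ N e c₁ c₂ c₃ (2 * n + 2) (2 * i + 1) =
      b ⬝ᵥ testVal Q α₀ β₀ a₀ b₀ N e c₁ c₂ c₃ (2 * n) (i / 2) +
        sgn i * (b ⬝ᵥ incr c₁ c₂ c₃ (diff Q α₀ β₀ a₀ b₀ N e) (2 * n) (i / 2)) -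
        c₃ / √2 * (rotAmp (stopEigen Q α₀ β₀ (n + 1)) * (a ⬝ᵥ e) +
          fillAmp Q (stopEigen Q α₀ β₀ n) * (b ⬝ᵥ e)) := by
  simp only [testVal, partialVal]
  rw [show (2 * i + 1) / 2 = i by omega, incr_odd, diff_stopping hn h, diff_terminal hA h,
    sgn_two_mul_add_one]
  simp only [dotProduct_add, dotProduct_smul, dotProduct_neg, dotProduct_sub, smul_eq_mul, ho.bb,
    ho.ba]
  ring

lemma rotB_dotProduct_testVal_terminal (hA : Admissible Q α₀ β₀ a₀ b₀) (hn : n + 1 < N)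
    (ho : OrthoPair a b)
    (h : node Q α₀ β₀ a₀ b₀ N (2 * n + 1) i = ⟨.rotated n, (stopEigen Q α₀ β₀ n).rotate, a, b⟩) :
    b ⬝ᵥ testVal Q α₀ β₀ a₀ b₀ N e c₁ c₂ c₃ (2 * n + 3) (4 * i + 1) =
      b ⬝ᵥ testVal Q α₀ β₀ a₀ b₀ N e c₁ c₂ c₃ (2 * n) (i / 2) +
        sgn i * (b ⬝ᵥ incr c₁ c₂ c₃ (diff Q α₀ β₀ a₀ b₀ N e) (2 * n) (i / 2)) +
        ((c₃ / √2 + c₂) * rotAmp (stopEigen Q α₀ β₀ (n + 1)) * (a ⬝ᵥ e) +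
          (c₃ / √2 * fillAmp Q (stopEigen Q α₀ β₀ n) -
            c₁ * √2 * stretchAmp Q (stopEigen Q α₀ β₀ n)) * (b ⬝ᵥ e)) := by
  simp only [testVal, partialVal]
  have h4 : sgn (4 * i + 1) = 1 := by
    rw [show 4 * i + 1 = 2 * (2 * i) + 1 by ring, sgn_two_mul_add_one]
  rw [show (4 * i + 1) / 2 = 2 * i by omega, show 2 * i / 2 = i by omega, incr_odd, incr_even,
    diff_stopping hn h, diff_terminal hA h, sibling_two_mul, diff_stopping hn h,
    show 2 * i / 2 = i by omega, diff_rotated h, h4, sgn_two_mul]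
  simp only [dotProduct_add, dotProduct_smul, dotProduct_neg, dotProduct_sub, smul_eq_mul, ho.bb,
    ho.ba]
  ring

/-! ### Averages over the stopping intervals -/

/-- `2ⁿ` times the product of the cosines of the rotation angles. -/
def cosProd (Q α₀ β₀ : ℝ) : ℕ → ℝ
  | 0 => 1
  | n + 1 => 2 * (√(1 + (stopEigen Q α₀ β₀ n).delta ^ 2))⁻¹ * cosProd Q α₀ β₀ n

/-- Normalized average of `(b, Tf)` over the stopping intervals of generation `n`. -/
def drift (Q α₀ β₀ c₁ c₂ c₃ v : ℝ) : ℕ → ℝ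
  | 0 => 0
  | n + 1 => drift Q α₀ β₀ c₁ c₂ c₃ v n -
      (stopEigen Q α₀ β₀ n).delta * stopAmpA Q α₀ β₀ c₁ c₂ n -
      c₃ / √2 * (rotAmp (stopEigen Q α₀ β₀ (n + 1)) + fillAmp Q (stopEigen Q α₀ β₀ n) * v)

lemma sum_basis_stops (hn : n ≤ N) :
    ∑ j ∈ stops n, (node Q α₀ β₀ a₀ b₀ N (2 * n) j).a ⬝ᵥ e = cosProd Q α₀ β₀ n * (a₀ ⬝ᵥ e) ∧
    ∑ j ∈ stops n, (node Q α₀ β₀ a₀ b₀ N (2 * n) j).b ⬝ᵥ e = cosProd Q α₀ β₀ n * (b₀ ⬝ᵥ e) := by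
  induction n with
  | zero => simp [stops, cosProd, node]
  | succ n ih =>
    obtain ⟨i1, i2⟩ := ih (by omega)
    rw [cosProd, mul_assoc _ _ (a₀ ⬝ᵥ e), mul_assoc _ _ (b₀ ⬝ᵥ e), ← i1, ← i2, Finset.mul_sum, Finset.mul_sum, sum_stops_succ,
      sum_stops_succ]
    constructor
    all_goals
      refine Finset.sum_congr rfl fun j hj => ?_
      obtain ⟨a, b, hab⟩ := node_of_mem_stops (Q := Q) (α₀ := α₀) (β₀ := β₀) (a₀ := a₀) (b₀ := b₀)
        (N := N) (n := n) (by omega) hj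
      obtain ⟨h1, h2⟩ := node_rotated_of_stopping (by omega) hab
      rw [show 4 * j + 1 = 2 * (2 * j) + 1 by ring, show 4 * j + 3 = 2 * (2 * j + 1) + 1 by ring,
        show 2 * (n + 1) = 2 * n + 2 by ring, (node_children_of_rotated h1).2.1,
        (node_children_of_rotated h2).2.1, hab]
      simp only [rotA, rotB, smul_dotProduct, add_dotProduct, sub_dotProduct, smul_eq_mul]
      ring

lemma sum_testVal_stops (hA : Admissible Q α₀ β₀ a₀ b₀) (hn : n < N) (he : a₀ ⬝ᵥ e = 1) :
    ∑ j ∈ stops n, (node Q α₀ β₀ a₀ b₀ N (2 * n) j).b ⬝ᵥ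
        testVal Q α₀ β₀ a₀ b₀ N e c₁ c₂ c₃ (2 * n) j =
      cosProd Q α₀ β₀ n * drift Q α₀ β₀ c₁ c₂ c₃ (b₀ ⬝ᵥ e) n := by
  induction n with
  | zero => simp [stops, drift, testVal, partialVal]
  | succ n ih =>
    obtain ⟨i1, i2⟩ := sum_basis_stops (Q := Q) (α₀ := α₀) (β₀ := β₀) (a₀ := a₀) (b₀ := b₀)
      (e := e) (n := n) (N := N) (by omega)
    have i3 := ih (by omega)
    rw [he, mul_one] at i1
    have key : ∀ j ∈ stops n,
        (node Q α₀ β₀ a₀ b₀ N (2 * (n + 1)) (4 * j + 1)).b ⬝ᵥ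
            testVal Q α₀ β₀ a₀ b₀ N e c₁ c₂ c₃ (2 * (n + 1)) (4 * j + 1) +
          (node Q α₀ β₀ a₀ b₀ N (2 * (n + 1)) (4 * j + 3)).b ⬝ᵥ
            testVal Q α₀ β₀ a₀ b₀ N e c₁ c₂ c₃ (2 * (n + 1)) (4 * j + 3) =
        2 * (√(1 + (stopEigen Q α₀ β₀ n).delta ^ 2))⁻¹ *
          ((node Q α₀ β₀ a₀ b₀ N (2 * n) j).b ⬝ᵥ testVal Q α₀ β₀ a₀ b₀ N e c₁ c₂ c₃ (2 * n) j -
          (stopEigen Q α₀ β₀ n).delta * stopAmpA Q α₀ β₀ c₁ c₂ n *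
            ((node Q α₀ β₀ a₀ b₀ N (2 * n) j).a ⬝ᵥ e) -
          c₃ / √2 * (rotAmp (stopEigen Q α₀ β₀ (n + 1)) *
              ((node Q α₀ β₀ a₀ b₀ N (2 * n) j).a ⬝ᵥ e) +
            fillAmp Q (stopEigen Q α₀ β₀ n) * ((node Q α₀ β₀ a₀ b₀ N (2 * n) j).b ⬝ᵥ e))) := by
      intro j hj
      obtain ⟨a, b, hab⟩ := node_of_mem_stops (Q := Q) (α₀ := α₀) (β₀ := β₀) (a₀ := a₀) (b₀ := b₀)
        (N := N) (n := n) (by omega) hj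
      have ho : OrthoPair a b := by
        have := (node_valid (N := N) hA (2 * n) j).ortho
        rwa [hab] at this
      obtain ⟨h1, h2⟩ := node_rotated_of_stopping (by omega) hab
      obtain ⟨κ, hκ⟩ := exists_incr_of_mem_stops (n := n) (e := e) (c₁ := c₁) (c₂ := c₂) (c₃ := c₃) hA
        (by omega) hj hab
      rw [show 4 * j + 1 = 2 * (2 * j) + 1 by ring, show 4 * j + 3 = 2 * (2 * j + 1) + 1 by ring,
        show 2 * (n + 1) = 2 * n + 2 by ring, (node_children_of_rotated h1).2.1,
        (node_children_of_rotated h2).2.1, hab]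
      dsimp only
      rw [rotB_dotProduct_testVal_stopping hA hn (ho.rot _ (Or.inr rfl)) h1,
        rotB_dotProduct_testVal_stopping hA hn (ho.rot _ (Or.inl rfl)) h2,
        show 2 * j / 2 = j by omega, show (2 * j + 1) / 2 = j by omega, hκ, sgn_two_mul,
        sgn_two_mul_add_one]
      simp only [rotA, rotB, smul_dotProduct, add_dotProduct, sub_dotProduct, dotProduct_add,
        dotProduct_smul, smul_eq_mul, ho.aa, ho.bb, ho.ab, ho.ba]
      ring
    rw [sum_stops_succ, Finset.sum_congr rfl key, ← Finset.mul_sum, Finset.sum_sub_distrib,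
      Finset.sum_sub_distrib, ← Finset.mul_sum, ← Finset.mul_sum, Finset.sum_add_distrib,
      ← Finset.mul_sum, ← Finset.mul_sum, i1, i2, i3, cosProd, drift]
    ring

/-- `(b, Tf)` on the right half of the terminal left child of the rotated interval
`(2n + 1, i)`. -/
def terminalVal (Q α₀ β₀ : ℝ) (a₀ b₀ : Fin 2 → ℝ) (N : ℕ) (e : Fin 2 → ℝ) (c₁ c₂ c₃ : ℝ)
    (n i : ℕ) : ℝ :=
  (node Q α₀ β₀ a₀ b₀ N (2 * n + 3) (4 * i + 1)).b ⬝ᵥ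
    testVal Q α₀ β₀ a₀ b₀ N e c₁ c₂ c₃ (2 * n + 3) (4 * i + 1)

/-- Normalized average of `(b, Tf)` over the right halves of the terminal intervals. -/
def terminalDrift (Q α₀ β₀ c₁ c₂ c₃ v : ℝ) (n : ℕ) : ℝ :=
  drift Q α₀ β₀ c₁ c₂ c₃ v n - (stopEigen Q α₀ β₀ n).delta * stopAmpA Q α₀ β₀ c₁ c₂ n +
    ((c₃ / √2 + c₂) * rotAmp (stopEigen Q α₀ β₀ (n + 1)) +
      (c₃ / √2 * fillAmp Q (stopEigen Q α₀ β₀ n) -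
        c₁ * √2 * stretchAmp Q (stopEigen Q α₀ β₀ n)) * v)

lemma sum_terminalVal (hA : Admissible Q α₀ β₀ a₀ b₀) (hn : n + 1 < N) (he : a₀ ⬝ᵥ e = 1) :
    ∑ j ∈ stops n, (terminalVal Q α₀ β₀ a₀ b₀ N e c₁ c₂ c₃ n (2 * j) +
        terminalVal Q α₀ β₀ a₀ b₀ N e c₁ c₂ c₃ n (2 * j + 1)) =
      cosProd Q α₀ β₀ (n + 1) * terminalDrift Q α₀ β₀ c₁ c₂ c₃ (b₀ ⬝ᵥ e) n := by
  obtain ⟨i1, i2⟩ := sum_basis_stops (Q := Q) (α₀ := α₀) (β₀ := β₀) (a₀ := a₀) (b₀ := b₀)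
    (e := e) (n := n) (N := N) (by omega)
  have i3 := sum_testVal_stops (c₁ := c₁) (c₂ := c₂) (c₃ := c₃) (n := n) (N := N) hA (by omega) he
  rw [he, mul_one] at i1
  have key : ∀ j ∈ stops n, terminalVal Q α₀ β₀ a₀ b₀ N e c₁ c₂ c₃ n (2 * j) +
        terminalVal Q α₀ β₀ a₀ b₀ N e c₁ c₂ c₃ n (2 * j + 1) =
      2 * (√(1 + (stopEigen Q α₀ β₀ n).delta ^ 2))⁻¹ *
        ((node Q α₀ β₀ a₀ b₀ N (2 * n) j).b ⬝ᵥ testVal Q α₀ β₀ a₀ b₀ N e c₁ c₂ c₃ (2 * n) j -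
        (stopEigen Q α₀ β₀ n).delta * stopAmpA Q α₀ β₀ c₁ c₂ n *
          ((node Q α₀ β₀ a₀ b₀ N (2 * n) j).a ⬝ᵥ e) +
        ((c₃ / √2 + c₂) * rotAmp (stopEigen Q α₀ β₀ (n + 1)) *
            ((node Q α₀ β₀ a₀ b₀ N (2 * n) j).a ⬝ᵥ e) +
          (c₃ / √2 * fillAmp Q (stopEigen Q α₀ β₀ n) -
            c₁ * √2 * stretchAmp Q (stopEigen Q α₀ β₀ n)) *
              ((node Q α₀ β₀ a₀ b₀ N (2 * n) j).b ⬝ᵥ e))) := by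
    intro j hj
    obtain ⟨a, b, hab⟩ := node_of_mem_stops (Q := Q) (α₀ := α₀) (β₀ := β₀) (a₀ := a₀) (b₀ := b₀)
      (N := N) (n := n) (by omega) hj
    have ho : OrthoPair a b := by
      have := (node_valid (N := N) hA (2 * n) j).ortho
      rwa [hab] at this
    obtain ⟨h1, h2⟩ := node_rotated_of_stopping (by omega) hab
    obtain ⟨κ, hκ⟩ := exists_incr_of_mem_stops (n := n) (e := e) (c₁ := c₁) (c₂ := c₂) (c₃ := c₃) hA
      (by omega) hj hab
    rw [terminalVal, terminalVal, (node_children_of_rotated h1).2.2,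
      (node_children_of_rotated h2).2.2, hab]
    dsimp only
    rw [rotB_dotProduct_testVal_terminal hA hn (ho.rot _ (Or.inr rfl)) h1,
      rotB_dotProduct_testVal_terminal hA hn (ho.rot _ (Or.inl rfl)) h2,
      show 2 * j / 2 = j by omega, show (2 * j + 1) / 2 = j by omega, hκ, sgn_two_mul,
      sgn_two_mul_add_one]
    simp only [rotA, rotB, smul_dotProduct, add_dotProduct, sub_dotProduct, dotProduct_add,
      dotProduct_smul, smul_eq_mul, ho.aa, ho.bb, ho.ab, ho.ba]
    ring
  rw [Finset.sum_congr rfl key, ← Finset.mul_sum, Finset.sum_add_distrib,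
    Finset.sum_sub_distrib, ← Finset.mul_sum, Finset.sum_add_distrib,
    ← Finset.mul_sum, ← Finset.mul_sum, i1, i2, i3, cosProd, terminalDrift]
  ring

end


/-! ### Estimates for the averages -/

lemma Eigen.Balanced.be_le_sqrt {Q : ℝ} {σ : Eigen} (h : σ.Balanced Q) :
    σ.be ≤ √(σ.al * σ.be) := by
  refine Real.le_sqrt_of_sq_le ?_
  nlinarith [h.be_pos, h.be_le_al]

lemma Eigen.Balanced.rotate_be_bounds {Q : ℝ} {σ : Eigen} (h : σ.Balanced Q) :
    0 ≤ σ.rotate.be ∧ σ.rotate.be ≤ √(σ.al * σ.be) := by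
  rw [h.rotate_be]
  have h1 := h.le_cofactor; have h2 := h.cofactor_le; have h3 := h.be_pos
  refine ⟨by positivity, le_trans ?_ h.be_le_sqrt⟩
  nlinarith

lemma Eigen.Balanced.rotAmp_bounds {Q : ℝ} {σ : Eigen} (h : σ.Balanced Q) :
    0 ≤ rotAmp σ ∧ rotAmp σ ≤ √(σ.al * σ.be) := by
  have h1 := h.rotate_be_bounds.1
  have h2 := h.rotate_be_le_al
  have h3 := Eigen.Balanced.delta_nonneg σ
  have h4 := h.al_mul_delta
  have h5 : σ.rotate.al ≤ 2 * σ.al := by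
    rw [h.rotate_al]; nlinarith [h.factor_le, h.al_pos]
  have h6 : σ.delta / (1 + σ.delta ^ 2) ≤ σ.delta := div_le_self h3 (by nlinarith)
  refine ⟨mul_nonneg (by positivity) (by linarith), ?_⟩
  calc rotAmp σ ≤ σ.delta * (2 * σ.al) := by
        refine mul_le_mul h6 (by linarith) (by linarith) h3
    _ ≤ _ := by nlinarith [Real.sqrt_nonneg (σ.al * σ.be)]

lemma Eigen.Balanced.fillAmp_bounds {Q : ℝ} {σ : Eigen} (h : σ.Balanced Q) (hQ : 2 ≤ Q) :
    0 ≤ fillAmp Q σ ∧ fillAmp Q σ ≤ 2 * √(σ.al * σ.be) := by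
  have h1 := fillParam_nonneg Q σ
  have h2 := fillParam_le_one hQ h
  have h3 := (h.stretchLeft_pos hQ).2.1
  have h4 : (σ.rotate.stretchLeft Q).be ≤ 2 * √(σ.al * σ.be) := by
    obtain ⟨h5, h6⟩ := h.rotate_be_bounds
    have := h.one_div_s_mul_pos hQ
    simp only [Eigen.stretchLeft]
    nlinarith
  exact ⟨mul_nonneg h1 h3.le, (mul_le_of_le_one_left h3.le h2).trans h4⟩

lemma Eigen.Balanced.stretchAmp_bounds {Q : ℝ} {σ : Eigen} (h : σ.Balanced Q) (hQ : 2 ≤ Q) :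
    0 ≤ -stretchAmp Q σ ∧ -stretchAmp Q σ ≤ √(σ.al * σ.be) := by
  obtain ⟨h5, h6⟩ := h.rotate_be_bounds
  have h1 := h.one_div_s_mul_pos hQ
  have h2 := h.one_div_s_mul_le hQ
  unfold stretchAmp
  constructor <;> nlinarith

lemma le_inv_sqrt_one_add {y : ℝ} (hy : 0 ≤ y) : 1 - y / 2 ≤ (√(1 + y))⁻¹ := by
  have h1 : √(1 + y) ≤ 1 + y / 2 := by
    rw [Real.sqrt_le_left (by positivity)]; nlinarith
  have h2 : 0 < √(1 + y) := Real.sqrt_pos.2 (by positivity)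
  have h3 : (1 + y / 2)⁻¹ ≤ (√(1 + y))⁻¹ := inv_anti₀ h2 h1
  refine le_trans ?_ h3
  rw [← one_div, le_div_iff₀ (by positivity)]
  nlinarith

section

variable {Q α₀ β₀ c₁ c₂ c₃ v : ℝ} (hQ : 2 ≤ Q) (hβ : 0 < β₀) (hαβ : β₀ ≤ α₀)

include hQ hβ hαβ

lemma le_cosProd (n : ℕ) : 2 ^ n / 2 ≤ cosProd Q α₀ β₀ n := by
  suffices h : 2 ^ n * (1 / 2 + 1 / 2 * (4 / 9) ^ n) ≤ cosProd Q α₀ β₀ n by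
    refine le_trans ?_ h
    have : (0 : ℝ) < 2 ^ n * (4 / 9) ^ n := by positivity
    linarith
  induction n with
  | zero => norm_num [cosProd]
  | succ n ih =>
    have hb := stopEigen_balanced hQ hβ hαβ n
    have h1 := le_inv_sqrt_one_add (sq_nonneg (stopEigen Q α₀ β₀ n).delta)
    rw [hb.delta_sq] at h1
    have h2 := stopEigen_ratio_le hQ hβ hαβ n
    have hx1 : ((4 : ℝ) / 9) ^ n ≤ 1 := pow_le_one₀ (by norm_num) (by norm_num)
    have hx0 : (0 : ℝ) < (4 / 9) ^ n := by positivity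
    rw [cosProd, pow_succ, pow_succ, hb.delta_sq]
    set x := ((4 : ℝ) / 9) ^ n
    set c := (√(1 + (stopEigen Q α₀ β₀ n).be / (stopEigen Q α₀ β₀ n).al / 100))⁻¹
    have h3 : 1 - x / 200 ≤ c := by linarith
    have h5 : (0 : ℝ) < 2 ^ n := by positivity
    calc (2 : ℝ) ^ n * 2 * (1 / 2 + 1 / 2 * (x * (4 / 9)))
        ≤ 2 * (1 - x / 200) * (2 ^ n * (1 / 2 + 1 / 2 * x)) := by
          have : 1 / 2 + 1 / 2 * (x * (4 / 9)) ≤ (1 - x / 200) * (1 / 2 + 1 / 2 * x) := by nlinarith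
          nlinarith
      _ ≤ 2 * c * cosProd Q α₀ β₀ n := by
          refine mul_le_mul (by linarith) ih (by positivity) (by linarith)

lemma delta_mul_rotate_al (n : ℕ) :
    (stopEigen Q α₀ β₀ (n + 1)).delta * (stopEigen Q α₀ β₀ n).rotate.al =
      √(α₀ * β₀) / (10 * stretchR Q) := by
  have hb := stopEigen_balanced hQ hβ hαβ n
  have h1 := (stopEigen_balanced hQ hβ hαβ (n + 1)).al_mul_delta
  have h2 := Eigen.Balanced.stretchR_ge hQ
  have h3 : (stopEigen Q α₀ β₀ (n + 1)).al = stretchR Q * (stopEigen Q α₀ β₀ n).rotate.al := rfl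
  rw [stopEigen_al_mul_be hQ hβ hαβ, h3] at h1
  rw [eq_div_iff (by positivity)]
  linarith

lemma le_delta_mul_stopAmpA (hc₁ : 0 < c₁) (hc₂ : 5 * |c₂| ≤ c₁ * Q) (n : ℕ) :
    c₁ / 30 * √(α₀ * β₀) ≤
      (stopEigen Q α₀ β₀ (n + 1)).delta * stopAmpA Q α₀ β₀ c₁ c₂ (n + 1) := by
  have h1 := delta_mul_rotate_al hQ hβ hαβ n
  have h2 := Eigen.Balanced.stretchR_ge hQ
  have hb := stopEigen_balanced hQ hβ hαβ n
  have ht0 := fillParam_nonneg Q (stopEigen Q α₀ β₀ n)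
  have ht1 := fillParam_le_one hQ hb
  set t := fillParam Q (stopEigen Q α₀ β₀ n) with ht
  have e : (stopEigen Q α₀ β₀ (n + 1)).delta * stopAmpA Q α₀ β₀ c₁ c₂ (n + 1) =
      (c₁ * √2 * (stretchR Q - 1) + c₂ * (t / Q)) *
        ((stopEigen Q α₀ β₀ (n + 1)).delta * (stopEigen Q α₀ β₀ n).rotate.al) := by
    rw [stopAmpA]; ring
  rw [e, h1]
  have hs : 7 / 5 ≤ √2 := Real.le_sqrt_of_sq_le (by norm_num)
  have hw := Real.sqrt_nonneg (α₀ * β₀)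
  have h3 : -(c₁ / 5) ≤ c₂ * (t / Q) := by
    have h4 : |c₂ * (t / Q)| ≤ c₁ / 5 := by
      rw [abs_mul, abs_of_nonneg (show 0 ≤ t / Q by positivity), ← mul_div_assoc,
        div_le_iff₀ (by linarith)]
      nlinarith [abs_nonneg c₂]
    exact (abs_le.1 h4).1
  have h5 : c₁ * (7 / 5) * (stretchR Q - 1) ≤ c₁ * √2 * (stretchR Q - 1) := by
    have : 0 ≤ stretchR Q - 1 := by linarith
    gcongr
  have h6 : c₁ / 3 * stretchR Q ≤ c₁ * √2 * (stretchR Q - 1) + c₂ * (t / Q) := by nlinarith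
  calc c₁ / 30 * √(α₀ * β₀) = c₁ / 3 * stretchR Q * (√(α₀ * β₀) / (10 * stretchR Q)) := by
        field_simp; ring
    _ ≤ _ := mul_le_mul_of_nonneg_right h6 (by positivity)

lemma drift_le (hc₁ : 0 < c₁) (hc₂ : 5 * |c₂| ≤ c₁ * Q) (hc₃ : 0 ≤ c₃) (hv : 0 ≤ v) (n : ℕ) :
    drift Q α₀ β₀ c₁ c₂ c₃ v n - (stopEigen Q α₀ β₀ n).delta * stopAmpA Q α₀ β₀ c₁ c₂ n ≤
      -(n * (c₁ / 30 * √(α₀ * β₀))) := by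
  induction n with
  | zero => simp [drift, stopAmpA]
  | succ n ih =>
    have h1 := le_delta_mul_stopAmpA hQ hβ hαβ hc₁ hc₂ n
    have h2 := (stopEigen_balanced hQ hβ hαβ (n + 1)).rotAmp_bounds.1
    have h3 := ((stopEigen_balanced hQ hβ hαβ n).fillAmp_bounds hQ).1
    have h4 : 0 ≤ c₃ / √2 * (rotAmp (stopEigen Q α₀ β₀ (n + 1)) +
        fillAmp Q (stopEigen Q α₀ β₀ n) * v) := by positivity
    rw [drift]
    push_cast
    linarith

lemma terminalDrift_le (hc₁ : 0 < c₁) (hc₂ : 5 * |c₂| ≤ c₁ * Q) (hc₃ : 0 ≤ c₃) (hv : 0 ≤ v)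
    (hv1 : v ≤ 1) (n : ℕ) :
    terminalDrift Q α₀ β₀ c₁ c₂ c₃ v n ≤
      (2 * c₁ + |c₂| + 3 * c₃ - n * (c₁ / 30)) * √(α₀ * β₀) := by
  have h1 := drift_le hQ hβ hαβ hc₁ hc₂ hc₃ hv n
  obtain ⟨r0, r1⟩ := (stopEigen_balanced hQ hβ hαβ (n + 1)).rotAmp_bounds
  obtain ⟨f0, f1⟩ := (stopEigen_balanced hQ hβ hαβ n).fillAmp_bounds hQ
  obtain ⟨s0, s1⟩ := (stopEigen_balanced hQ hβ hαβ n).stretchAmp_bounds hQ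
  rw [stopEigen_al_mul_be hQ hβ hαβ] at r1 f1 s1
  have hw := Real.sqrt_nonneg (α₀ * β₀)
  have hs1 : √2 ≤ 2 := by rw [Real.sqrt_le_left (by norm_num)]; norm_num
  have hs0 : 1 ≤ √2 := Real.one_le_sqrt.2 (by norm_num)
  have hc : c₃ / √2 ≤ c₃ := div_le_self hc₃ hs0
  have hc0 : 0 ≤ c₃ / √2 := by positivity
  rw [terminalDrift]
  set w := √(α₀ * β₀)
  have e1 : (c₃ / √2 + c₂) * rotAmp (stopEigen Q α₀ β₀ (n + 1)) ≤ (c₃ + |c₂|) * w :=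
    mul_le_mul (add_le_add hc (le_abs_self _)) r1 r0 (by positivity)
  have e2 : c₃ / √2 * fillAmp Q (stopEigen Q α₀ β₀ n) ≤ c₃ * (2 * w) :=
    mul_le_mul hc f1 f0 hc₃
  have e3 : c₁ * √2 * -stretchAmp Q (stopEigen Q α₀ β₀ n) ≤ c₁ * 2 * w := by
    refine mul_le_mul (by gcongr) s1 s0 (by positivity)
  have e4 : (c₃ / √2 * fillAmp Q (stopEigen Q α₀ β₀ n) -
      c₁ * √2 * stretchAmp Q (stopEigen Q α₀ β₀ n)) * v ≤
      c₃ / √2 * fillAmp Q (stopEigen Q α₀ β₀ n) -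
      c₁ * √2 * stretchAmp Q (stopEigen Q α₀ β₀ n) := by
    refine mul_le_of_le_one_right ?_ hv1
    have : 0 ≤ c₁ * √2 * -stretchAmp Q (stopEigen Q α₀ β₀ n) := by positivity
    have : 0 ≤ c₃ / √2 * fillAmp Q (stopEigen Q α₀ β₀ n) := by positivity
    linarith
  linarith

omit hβ hαβ in
lemma half_le_stretchR_pow {n : ℕ} (hn : n ≤ Q) : 1 / 2 ≤ (stretchR Q / 2) ^ n := by
  have hQ0 : 0 < Q := by linarith
  have h1 : stretchR Q / 2 = 1 + -(1 / (2 * Q)) := by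
    rw [stretchR]; field_simp; ring
  have h2 : -2 ≤ -(1 / (2 * Q)) := by
    have : 1 / (2 * Q) ≤ 1 / 1 := one_div_le_one_div_of_le one_pos (by linarith)
    linarith
  have h3 := one_add_mul_le_pow h2 n
  rw [h1]
  refine le_trans ?_ h3
  have : (n : ℝ) * (1 / (2 * Q)) ≤ Q * (1 / (2 * Q)) := by gcongr
  have h4 : Q * (1 / (2 * Q)) = 1 / 2 := by field_simp
  linarith

/-- The contribution of the terminal intervals of generation `n ≤ Q`. -/
lemma terminal_contribution {a₀ b₀ e : Fin 2 → ℝ} {N n : ℕ} (ho : OrthoPair a₀ b₀)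
    (hc₁ : 0 < c₁) (hc₂ : 5 * |c₂| ≤ c₁ * Q) (hc₃ : 0 ≤ c₃)
    (he : a₀ ⬝ᵥ e = 1) (hv : 0 ≤ b₀ ⬝ᵥ e) (hv1 : b₀ ⬝ᵥ e ≤ 1)
    (hn : n + 1 < N) (hnQ : n ≤ Q) (hnc : 2 * (2 * c₁ + |c₂| + 3 * c₃) ≤ n * (c₁ / 30)) :
    α₀ * n ^ 2 * (c₁ / 30) ^ 2 / 128 ≤
      ∑ j ∈ stops n, ((stopEigen Q α₀ β₀ n).rotate.stretchLeft Q).alS * (2 ^ (2 * n + 3))⁻¹ *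
        (terminalVal Q α₀ β₀ a₀ b₀ N e c₁ c₂ c₃ n (2 * j) ^ 2 +
          terminalVal Q α₀ β₀ a₀ b₀ N e c₁ c₂ c₃ n (2 * j + 1) ^ 2) := by
  have hb := stopEigen_balanced hQ hβ hαβ n
  have hα : 0 < α₀ := hβ.trans_le hαβ
  have hsum := sum_terminalVal (c₁ := c₁) (c₂ := c₂) (c₃ := c₃) ⟨hQ, hβ, hαβ, ho⟩ hn he
  have hdr := terminalDrift_le hQ hβ hαβ hc₁ hc₂ hc₃ hv hv1 n
  have hcos := le_cosProd hQ hβ hαβ (n + 1)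
  set η := c₁ / 30 with hη
  set x := fun j => terminalVal Q α₀ β₀ a₀ b₀ N e c₁ c₂ c₃ n (2 * j) with hx
  set y := fun j => terminalVal Q α₀ β₀ a₀ b₀ N e c₁ c₂ c₃ n (2 * j + 1) with hy
  change ∑ j ∈ stops n, (x j + y j) = _ at hsum
  change _ ≤ ∑ j ∈ stops n, _ * (x j ^ 2 + y j ^ 2)
  have hcs := sq_sum_le_card_mul_sum_sq (s := stops n) (f := fun j => x j + y j)
  rw [hsum, card_stops] at hcs
  have h1 : ∑ j ∈ stops n, (x j + y j) ^ 2 ≤ 2 * ∑ j ∈ stops n, (x j ^ 2 + y j ^ 2) := by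
    rw [Finset.mul_sum]
    exact Finset.sum_le_sum fun j _ => by nlinarith [sq_nonneg (x j - y j)]
  have hww : √(α₀ * β₀) * √(α₀ * β₀) = α₀ * β₀ := Real.mul_self_sqrt (by positivity)
  have hw0 := Real.sqrt_nonneg (α₀ * β₀)
  set w := √(α₀ * β₀) with hw
  have h2 : terminalDrift Q α₀ β₀ c₁ c₂ c₃ (b₀ ⬝ᵥ e) n ≤ -(n * η * w / 2) := by nlinarith
  have h3 : (2 : ℝ) ^ n * (n * η * w / 2) ≤
      -(cosProd Q α₀ β₀ (n + 1) * terminalDrift Q α₀ β₀ c₁ c₂ c₃ (b₀ ⬝ᵥ e) n) := by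
    rw [← mul_neg]
    refine mul_le_mul ?_ (by linarith) (by positivity) (le_trans (by positivity) hcos)
    rw [pow_succ] at hcos; linarith
  have h4 : ((2 : ℝ) ^ n * (n * η * w / 2)) ^ 2 ≤
      (cosProd Q α₀ β₀ (n + 1) * terminalDrift Q α₀ β₀ c₁ c₂ c₃ (b₀ ⬝ᵥ e) n) ^ 2 := by
    rw [← neg_sq (cosProd _ _ _ _ * _)]
    exact pow_le_pow_left₀ (by positivity) h3 2
  have hp : (0 : ℝ) < 2 ^ n := by positivity
  set Z := ∑ j ∈ stops n, (x j ^ 2 + y j ^ 2) with hZ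
  have h5 : (2 : ℝ) ^ n * (n * η) ^ 2 * (α₀ * β₀) / 8 ≤ Z := by
    push_cast at hcs
    have h6 : ((2 : ℝ) ^ n * (n * η * w / 2)) ^ 2 ≤ 2 ^ n * (2 * Z) :=
      h4.trans (hcs.trans (by gcongr))
    have h7 : ((2 : ℝ) ^ n * (n * η * w / 2)) ^ 2 =
        2 ^ n * (2 * ((2 : ℝ) ^ n * (n * η) ^ 2 * (α₀ * β₀) / 8)) := by
      rw [← hww]; ring
    rw [h7] at h6
    have := le_of_mul_le_mul_left h6 hp
    linarith
  have h8 : stretchR Q ^ n * α₀ / (α₀ * β₀) ≤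
      ((stopEigen Q α₀ β₀ n).rotate.stretchLeft Q).alS := by
    rw [hb.stretchLeft_alS hQ, stopEigen_al_mul_be hQ hβ hαβ, hb.rotate_al]
    refine div_le_div_of_nonneg_right ((le_stopEigen_al hQ hβ hαβ n).trans ?_) (by positivity)
    nlinarith [hb.one_le_factor, hb.al_pos]
  have h9 := half_le_stretchR_pow hQ hnQ
  have h10 := Eigen.Balanced.stretchR_ge hQ
  rw [← Finset.mul_sum]
  calc α₀ * n ^ 2 * η ^ 2 / 128 = 1 / 2 * (α₀ * n ^ 2 * η ^ 2 / 64) := by ring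
    _ ≤ (stretchR Q / 2) ^ n * (α₀ * n ^ 2 * η ^ 2 / 64) := by gcongr
    _ = stretchR Q ^ n * α₀ / (α₀ * β₀) * (2 ^ (2 * n + 3))⁻¹ *
          (2 ^ n * (n * η) ^ 2 * (α₀ * β₀) / 8) := by
        rw [div_pow, pow_add, two_mul, pow_add]
        field_simp
        ring
    _ ≤ _ := by
        refine mul_le_mul (by gcongr) h5 (by positivity) ?_
        exact mul_nonneg (hb.stretchLeft_pos hQ).2.2.1.le (by positivity)

end


/-! ### The lower bound -/

lemma sum_lintegral_terminal_le (φ : ℝ → ENNReal) (M : ℕ) :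
    ∑ n ∈ Finset.range M, ∑ j ∈ stops n, ((∫⁻ x in dyadic (2 * n + 3) (4 * (2 * j) + 1), φ x) +
        ∫⁻ x in dyadic (2 * n + 3) (4 * (2 * j + 1) + 1), φ x) ≤
      ∫⁻ x in Set.Ico (0 : ℝ) 1, φ x := by
  suffices h : ∑ n ∈ Finset.range M, ∑ j ∈ stops n,
      ((∫⁻ x in dyadic (2 * n + 3) (4 * (2 * j) + 1), φ x) +
        ∫⁻ x in dyadic (2 * n + 3) (4 * (2 * j + 1) + 1), φ x) +
      ∑ j ∈ stops M, ∫⁻ x in dyadic (2 * M) j, φ x ≤ ∫⁻ x in Set.Ico (0 : ℝ) 1, φ x from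
    le_self_add.trans h
  induction M with
  | zero => simp [stops, dyadic_zero_zero]
  | succ M ih =>
    refine le_trans ?_ ih
    rw [Finset.sum_range_succ, add_assoc, sum_stops_succ, ← Finset.sum_add_distrib]
    gcongr with j hj
    rw [lintegral_dyadic_add φ (2 * M) j, lintegral_dyadic_add φ (2 * M + 1) (2 * j),
      lintegral_dyadic_add φ (2 * M + 1) (2 * j + 1),
      lintegral_dyadic_add φ (2 * M + 1 + 1) (2 * (2 * j)),
      lintegral_dyadic_add φ (2 * M + 1 + 1) (2 * (2 * j + 1)),
      show 2 * (M + 1) = 2 * M + 1 + 1 by ring, show 2 * M + 3 = 2 * M + 1 + 1 + 1 by ring,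
      show 4 * (2 * j) + 1 = 2 * (2 * (2 * j)) + 1 by ring,
      show 4 * (2 * j + 1) + 1 = 2 * (2 * (2 * j + 1)) + 1 by ring,
      show 4 * j + 1 = 2 * (2 * j) + 1 by ring, show 4 * j + 3 = 2 * (2 * j + 1) + 1 by ring]
    generalize ∫⁻ x in dyadic (2 * M + 1 + 1 + 1) (2 * (2 * (2 * j)) + 1), φ x = A
    generalize ∫⁻ x in dyadic (2 * M + 1 + 1 + 1) (2 * (2 * (2 * j + 1)) + 1), φ x = B
    generalize ∫⁻ x in dyadic (2 * M + 1 + 1) (2 * (2 * j) + 1), φ x = C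
    generalize ∫⁻ x in dyadic (2 * M + 1 + 1) (2 * (2 * j + 1) + 1), φ x = D
    generalize ∫⁻ x in dyadic (2 * M + 1 + 1 + 1) (2 * (2 * (2 * j))), φ x = A'
    generalize ∫⁻ x in dyadic (2 * M + 1 + 1 + 1) (2 * (2 * (2 * j + 1))), φ x = B'
    calc A + B + (C + D) = (0 + A + C) + (0 + B + D) := by ring
      _ ≤ (A' + A + C) + (B' + B + D) := by gcongr <;> exact zero_le

section

variable {Q α₀ β₀ : ℝ} {a₀ b₀ : Fin 2 → ℝ} {N : ℕ} {n : ℕ} {e : Fin 2 → ℝ} {c₁ c₂ c₃ : ℝ}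

/-- The squared weighted density of `Tf`. -/
def density (Q α₀ β₀ : ℝ) (a₀ b₀ : Fin 2 → ℝ) (N : ℕ) (e : Fin 2 → ℝ) (c₁ c₂ c₃ x : ℝ) : ENNReal :=
  ENNReal.ofReal ((weight Q α₀ β₀ a₀ b₀ N x *ᵥ
    genOp c₁ c₂ c₃ (testFun (weight Q α₀ β₀ a₀ b₀ N) e) x) ⬝ᵥ
    genOp c₁ c₂ c₃ (testFun (weight Q α₀ β₀ a₀ b₀ N) e) x)

lemma le_lintegral_density (hA : Admissible Q α₀ β₀ a₀ b₀) (hn : n < N) {i : ℕ}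
    (hi : i < 2 ^ (2 * n + 1))
    (h : ∃ a b, node Q α₀ β₀ a₀ b₀ N (2 * n + 1) i =
      ⟨.rotated n, (stopEigen Q α₀ β₀ n).rotate, a, b⟩) :
    ENNReal.ofReal (((stopEigen Q α₀ β₀ n).rotate.stretchLeft Q).alS * (2 ^ (2 * n + 3))⁻¹ *
        terminalVal Q α₀ β₀ a₀ b₀ N e c₁ c₂ c₃ n i ^ 2) ≤
      ∫⁻ x in dyadic (2 * n + 3) (4 * i + 1), density Q α₀ β₀ a₀ b₀ N e c₁ c₂ c₃ x := by
  obtain ⟨a, b, hab⟩ := h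
  have hk := (node_children_of_rotated hab).2.2
  have hc : (node Q α₀ β₀ a₀ b₀ N (2 * n + 3) (4 * i + 1)).role = .const := by rw [hk]
  have hi' : 4 * i + 1 < 2 ^ (2 * n + 3) := by
    rw [show 2 * n + 3 = 2 * n + 1 + 2 by ring, pow_add]; omega
  have hval : ∀ x ∈ dyadic (2 * n + 3) (4 * i + 1), density Q α₀ β₀ a₀ b₀ N e c₁ c₂ c₃ x =
      ENNReal.ofReal (((node Q α₀ β₀ a₀ b₀ N (2 * n + 3) (4 * i + 1)).avgW *ᵥ
        testVal Q α₀ β₀ a₀ b₀ N e c₁ c₂ c₃ (2 * n + 3) (4 * i + 1)) ⬝ᵥ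
        testVal Q α₀ β₀ a₀ b₀ N e c₁ c₂ c₃ (2 * n + 3) (4 * i + 1)) := by
    intro x hx
    rw [density, genOp_testFun hA e c₁ c₂ c₃ (by omega) (by omega) hi' hc hx,
      weight_eq_of_const hA hc hx]
  rw [lintegral_dyadic_const hval, ← ENNReal.ofReal_mul' (by positivity), avgW_mulVec_dotProduct]
  refine ENNReal.ofReal_le_ofReal ?_
  have hv : terminalVal Q α₀ β₀ a₀ b₀ N e c₁ c₂ c₃ n i =
      b ⬝ᵥ testVal Q α₀ β₀ a₀ b₀ N e c₁ c₂ c₃ (2 * n + 3) (4 * i + 1) := by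
    rw [terminalVal, hk]
  obtain ⟨-, h2, -, -⟩ := roleInv_const hA hc
  have h1 : ((stopEigen Q α₀ β₀ n).rotate.stretchLeft Q).alS ≤
      (node Q α₀ β₀ a₀ b₀ N (2 * n + 3) (4 * i + 1)).eig.alS := by
    rw [hk]
    have hf := (stopEigen_balanced hA.two_le hA.be_pos hA.be_le_al n).fillable_stretchLeft hA.two_le
    refine le_mul_of_one_le_right hf.alS_pos.le ?_
    rw [one_mul]
    exact le_add_of_nonneg_right (Real.sqrt_nonneg _)
  have hb : (node Q α₀ β₀ a₀ b₀ N (2 * n + 3) (4 * i + 1)).b = b := by rw [hk]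
  rw [hv, mul_right_comm, hb]
  gcongr
  refine le_add_of_nonneg_of_le (by positivity) ?_
  gcongr

lemma terminal_le_lintegral_density (hA : Admissible Q α₀ β₀ a₀ b₀)
    (hc₁ : 0 < c₁) (hc₂ : 5 * |c₂| ≤ c₁ * Q) (hc₃ : 0 ≤ c₃)
    (he : a₀ ⬝ᵥ e = 1) (hv : 0 ≤ b₀ ⬝ᵥ e) (hv1 : b₀ ⬝ᵥ e ≤ 1)
    (hn : n + 1 < N) (hnQ : n ≤ Q) (hnc : 2 * (2 * c₁ + |c₂| + 3 * c₃) ≤ n * (c₁ / 30)) :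
    ENNReal.ofReal (α₀ * n ^ 2 * (c₁ / 30) ^ 2 / 128) ≤
      ∑ j ∈ stops n,
        ((∫⁻ x in dyadic (2 * n + 3) (4 * (2 * j) + 1), density Q α₀ β₀ a₀ b₀ N e c₁ c₂ c₃ x) +
        ∫⁻ x in dyadic (2 * n + 3) (4 * (2 * j + 1) + 1),
          density Q α₀ β₀ a₀ b₀ N e c₁ c₂ c₃ x) := by
  have hpos := ((stopEigen_balanced hA.two_le hA.be_pos hA.be_le_al n).stretchLeft_pos
    hA.two_le).2.2.1
  refine (ENNReal.ofReal_le_ofReal (terminal_contribution hA.two_le hA.be_pos hA.be_le_al hA.ortho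
    hc₁ hc₂ hc₃ he hv hv1 hn hnQ hnc)).trans ?_
  rw [ENNReal.ofReal_sum_of_nonneg fun j _ => by positivity]
  refine Finset.sum_le_sum fun j hj => ?_
  rw [mul_add, ENNReal.ofReal_add (by positivity) (by positivity)]
  obtain ⟨a, b, hab⟩ := node_of_mem_stops (Q := Q) (α₀ := α₀) (β₀ := β₀) (a₀ := a₀) (b₀ := b₀)
    (N := N) (n := n) (by omega) hj
  obtain ⟨h1, h2⟩ := node_rotated_of_stopping (by omega) hab
  have hlt := lt_of_mem_stops hj
  have hp : 2 ^ (2 * n + 1) = 2 * 2 ^ (2 * n) := pow_succ' _ _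
  exact add_le_add (le_lintegral_density hA (by omega) (by omega) ⟨_, _, h1⟩)
    (le_lintegral_density hA (by omega) (by omega) ⟨_, _, h2⟩)

lemma le_lintegral_density_Ico (hA : Admissible Q α₀ β₀ a₀ b₀)
    (hc₁ : 0 < c₁) (hc₂ : 5 * |c₂| ≤ c₁ * Q) (hc₃ : 0 ≤ c₃)
    (he : a₀ ⬝ᵥ e = 1) (hv : 0 ≤ b₀ ⬝ᵥ e) (hv1 : b₀ ⬝ᵥ e ≤ 1) (hQ8 : 8 ≤ Q)
    (hN : Q + 2 ≤ N) (hQc : 4 * (2 * c₁ + |c₂| + 3 * c₃) ≤ Q * (c₁ / 30)) :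
    ENNReal.ofReal (α₀ * Q ^ 3 * (c₁ / 30) ^ 2 / 2048) ≤
      ∫⁻ x in Set.Ico (0 : ℝ) 1, density Q α₀ β₀ a₀ b₀ N e c₁ c₂ c₃ x := by
  have hα : 0 < α₀ := hA.be_pos.trans_le hA.be_le_al
  refine le_trans ?_ (sum_lintegral_terminal_le _ ⌊Q⌋₊)
  have hfl : (⌊Q⌋₊ : ℝ) ≤ Q := Nat.floor_le (by linarith)
  have hfl2 : Q < ⌊Q⌋₊ + 1 := Nat.lt_floor_add_one Q
  have hce : (⌈Q / 2⌉₊ : ℝ) < Q / 2 + 1 := Nat.ceil_lt_add_one (by linarith)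
  have hce2 : Q / 2 ≤ ⌈Q / 2⌉₊ := Nat.le_ceil _
  have hle : ⌈Q / 2⌉₊ ≤ ⌊Q⌋₊ := by
    have : (⌈Q / 2⌉₊ : ℝ) ≤ ⌊Q⌋₊ := by linarith
    exact_mod_cast this
  have hterm : ∀ n ∈ Finset.Ico ⌈Q / 2⌉₊ ⌊Q⌋₊,
      ENNReal.ofReal (α₀ * (Q / 2) ^ 2 * (c₁ / 30) ^ 2 / 128) ≤ ∑ j ∈ stops n,
        ((∫⁻ x in dyadic (2 * n + 3) (4 * (2 * j) + 1), density Q α₀ β₀ a₀ b₀ N e c₁ c₂ c₃ x) +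
        ∫⁻ x in dyadic (2 * n + 3) (4 * (2 * j + 1) + 1),
          density Q α₀ β₀ a₀ b₀ N e c₁ c₂ c₃ x) := by
    intro n hn
    obtain ⟨h1, h2⟩ := Finset.mem_Ico.1 hn
    have h1' : Q / 2 ≤ n := hce2.trans (by exact_mod_cast h1)
    have h2' : (n : ℝ) ≤ Q := le_trans (by exact_mod_cast h2.le) hfl
    have h3 : n + 1 < N := by
      have : ((n + 1 : ℕ) : ℝ) < N := by push_cast; linarith
      exact_mod_cast this
    refine le_trans (ENNReal.ofReal_le_ofReal ?_) (terminal_le_lintegral_density hA hc₁ hc₂ hc₃ he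
      hv hv1 h3 h2' ?_)
    · gcongr
    · have : Q / 2 * (c₁ / 30) ≤ n * (c₁ / 30) := by gcongr
      linarith
  refine le_trans ?_ (Finset.sum_le_sum_of_subset
    (s := Finset.Ico ⌈Q / 2⌉₊ ⌊Q⌋₊) fun n hn => Finset.mem_range.2 (Finset.mem_Ico.1 hn).2)
  refine le_trans ?_ (Finset.card_nsmul_le_sum _ _ _ hterm)
  rw [nsmul_eq_mul, ← ENNReal.ofReal_natCast, ← ENNReal.ofReal_mul (by positivity)]
  refine ENNReal.ofReal_le_ofReal ?_
  rw [Nat.card_Ico, Nat.cast_sub hle]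
  have hcard : Q / 4 ≤ (⌊Q⌋₊ : ℝ) - ⌈Q / 2⌉₊ := by linarith
  calc α₀ * Q ^ 3 * (c₁ / 30) ^ 2 / 2048 =
        Q / 4 * (α₀ * (Q / 2) ^ 2 * (c₁ / 30) ^ 2 / 128) := by ring
    _ ≤ _ := by gcongr

end

lemma lowerBound_genOp {c₁ c₃ : ℝ} (c₂ : ℝ) (hc₁ : 0 < c₁) (hc₃ : 0 ≤ c₃) :
    LowerBound (genOp c₁ c₂ c₃) := by
  have hη : 0 < c₁ / 30 := by positivity
  refine ⟨c₁ / 30 / 64, by positivity,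
    8 + 5 * |c₂| / c₁ + 4 * (2 * c₁ + |c₂| + 3 * c₃) / (c₁ / 30), fun Q hQ =>
    ⟨1 / 10, by norm_num, fun α₀ β₀ hα hβ hδ => ⟨⌈Q⌉₊ + 2, fun N hN a₀ b₀ e haa hbb hab he => ?_⟩⟩⟩
  have p1 : 0 ≤ 5 * |c₂| / c₁ := by positivity
  have p2 : 0 ≤ 4 * (2 * c₁ + |c₂| + 3 * c₃) / (c₁ / 30) := by positivity
  have hQ8 : 8 ≤ Q := by linarith
  have hQ1 : 5 * |c₂| ≤ c₁ * Q := by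
    rw [mul_comm c₁, ← div_le_iff₀ hc₁]; linarith
  have hQ2 : 4 * (2 * c₁ + |c₂| + 3 * c₃) ≤ Q * (c₁ / 30) := by
    rw [← div_le_iff₀ hη]; linarith
  have hαβ : β₀ ≤ α₀ := by
    have h1 : √(β₀ / α₀) ≤ 1 := by linarith
    rwa [Real.sqrt_le_one, div_le_one hα] at h1
  have ho : OrthoPair a₀ b₀ := ⟨haa, hbb, hab⟩
  have hA : Admissible Q α₀ β₀ a₀ b₀ := ⟨by linarith, hβ, hαβ, ho⟩
  have hNQ : Q + 2 ≤ N := by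
    have h1 : Q ≤ ⌈Q⌉₊ := Nat.le_ceil Q
    have h2 : ((⌈Q⌉₊ + 2 : ℕ) : ℝ) ≤ N := by exact_mod_cast hN
    push_cast at h2
    linarith
  have hae : a₀ ⬝ᵥ e = 1 := by
    rcases he with rfl | rfl
    · exact haa
    · rw [dotProduct_add, haa, hab, add_zero]
  have hbe : b₀ ⬝ᵥ e = 0 ∨ b₀ ⬝ᵥ e = 1 := by
    rcases he with rfl | rfl
    · exact Or.inl ho.ba
    · right; rw [dotProduct_add, ho.ba, hbb, zero_add]
  have hv : 0 ≤ b₀ ⬝ᵥ e := by rcases hbe with h | h <;> rw [h]; norm_num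
  have hv1 : b₀ ⬝ᵥ e ≤ 1 := by rcases hbe with h | h <;> rw [h]; norm_num
  have hmain := le_lintegral_density_Ico (N := N) hA hc₁ hQ1 hc₃ hae hv hv1 hQ8 hNQ hQ2
  have hQ0 : 0 ≤ Q := by linarith
  have hcQ : c₁ / 30 / 64 * Q ^ (3 / 2 : ℝ) = ((c₁ / 30 / 64) ^ 2 * Q ^ 3) ^ (1 / 2 : ℝ) := by
    rw [Real.mul_rpow (by positivity) (by positivity), ← Real.sqrt_eq_rpow,
      Real.sqrt_sq (by positivity), ← Real.rpow_natCast, ← Real.rpow_mul hQ0]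
    norm_num
  rw [weightedNorm_testFun hA, hcQ, ← ENNReal.ofReal_rpow_of_nonneg (by positivity) (by norm_num),
    ← ENNReal.mul_rpow_of_nonneg _ _ (by norm_num), weightedNorm]
  refine ENNReal.rpow_le_rpow (le_trans ?_ hmain) (by norm_num)
  rw [← ENNReal.ofReal_mul (by positivity)]
  refine ENNReal.ofReal_le_ofReal ?_
  have hn : α₀ * (a₀ ⬝ᵥ e) ^ 2 + β₀ * (b₀ ⬝ᵥ e) ^ 2 ≤ 2 * α₀ := by
    rw [hae]
    rcases hbe with h | h <;> rw [h] <;> linarith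
  calc _ ≤ (c₁ / 30 / 64) ^ 2 * Q ^ 3 * (2 * α₀) := by gcongr
    _ = _ := by ring

lemma LowerBound.of_eq_neg {T T' : (ℝ → Fin 2 → ℝ) → ℝ → Fin 2 → ℝ} (h : LowerBound T)
    (hT : ∀ f x, T' f x = -T f x) : LowerBound T' := by
  have : ∀ W f, weightedNorm W (T' f) = weightedNorm W (T f) := fun W f => by
    simp only [weightedNorm, hT, Matrix.mulVec_neg, neg_dotProduct_neg]
  simpa only [LowerBound, this] using h

end DyadicModel
end

theorem lemma5p1 :
    (∀ c₁ c₂ : ℝ, c₁ ≠ 0 → DyadicModel.LowerBound (DyadicModel.modelOp c₁ c₂)) ∧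
      DyadicModel.LowerBound DyadicModel.oddShift := by
  constructor
  · intro c₁ c₂ hc
    rcases lt_or_gt_of_ne hc with hc | hc
    · refine (DyadicModel.lowerBound_genOp (-c₂) (neg_pos.2 hc) (neg_pos.2 hc).le).of_eq_neg ?_
      intro f x
      rw [DyadicModel.modelOp, DyadicModel.genOp]
      module
    · have h : DyadicModel.modelOp c₁ c₂ = DyadicModel.genOp c₁ c₂ c₁ := by
        funext f x
        rw [DyadicModel.modelOp, DyadicModel.genOp, smul_sub]
      rw [h]
      exact DyadicModel.lowerBound_genOp c₂ hc hc.le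
  · have h : DyadicModel.oddShift = DyadicModel.genOp 1 0 0 := by
      funext f x
      simp [DyadicModel.genOp]
    rw [h]
    exact DyadicModel.lowerBound_genOp 0 one_pos le_rfl
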